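/- Let $c(j)$ be the coefficient of $q^j$ in $J(q)=j(q)-744=q^{-1}+196884q+\cdots$, let $I=\{(j,k)\mid j\in\{-1,1,2,\dots\},\ 1\le k\le c(j)\}$ and $I^{\rm im}=\{(j,k)\in I\mid j\ge1\}$. Let $\mathfrak g(A)$ be the complex Lie algebra with generators $e_{jk},f_{jk},h_{jk}$, $(j,k)\in I$, and relations $[h_{jk},h_{pq}]=0$, $[h_{jk},e_{pq}]=-(j+p)e_{pq}$, $[h_{jk},f_{pq}]=(j+p)f_{pq}$, $[e_{jk},f_{pq}]=\delta_{jp}\delta_{kq}h_{jk}$ for all indices in $I$, and $({\rm ad}\,e_{-1\,1})^je_{jk}=({\rm ad}\,f_{-1\,1})^jf_{jk}=0$ for $(j,k)\in I^{\rm im}$ (the Borcherds algebra whose quotient by its centre is the Monster Lie algebra). For $(j,k)\in I\setminus\{(\pm1,1)\}$ let $D_{jk}$ be the derivation of $\mathfrak g(A)$ with $D_{jk}(e_{pq})=\delta_{jp}\delta_{kq}e_{jk}$, $D_{jk}(f_{pq})=-\delta_{jp}\delta_{kq}f_{jk}$, $D_{jk}(h_{pq})=0$; let $\mathfrak d_0$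 be their span, $\mathfrak g^e=\mathfrak d_0\ltimes\mathfrak g(A)$ and $\mathfrak h^e=\mathfrak d_0\oplus\sum\mathbb C h_{jk}$. Let $\Delta\subseteq(\mathfrak h^e)^*$ be the set of roots, i.e. of nonzero $\alpha$ for which some nonzero $x\in\mathfrak g(A)$ satisfies $[h,x]=\alpha(h)x$ for all $h\in\mathfrak h^e$. Let $\alpha_{jk}$ be the simple root with root vector $e_{jk}$, $\alpha_{-1}=\alpha_{-1\,1}$, and let $Q$ be the lattice with basis the $\alpha_{jk}$ and with the form $(\alpha_{jk},\alpha_{pq})=-(j+p)$. A root is positive if its coefficients in the simple roots are nonnegative, and imaginary if $(\alpha,\alpha)\le0$. For $(j,k)\in I^{\rm im}$ put $\alpha_{\ell,jk}=\ell\alpha_{-1}+\alpha_{jk}$. For $\alpha,\beta\in\Delta$ let $\Sigma(\alpha,\beta)=\bigcup_{n\ge1}\Sigma_n$, where $\Sigma_1=\{\alpha+\beta\}\cap\Delta$ and $\Sigma_n=\{\gamma+\alpha,\gamma+\beta\mid\gamma\in\Sigma_{n-1}\}\cap\Delta$. Write $\mathbb N=\{1,2,\dots\}$. **(A)** Let $\alpha=\ell\alpha_{-1}+\sum_{(j,k)\in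 I^{\rm im}}c_{jk}\alpha_{jk}\in Q$. Then $\alpha$ is a positive imaginary root if and only if (i) $\ell\ge0$, all $c_{jk}\ge0$ and at least one $c_{jk}>0$; (ii) $\ell\le\sum(j-1)c_{jk}$; and (iii) if exactly one coefficient $c_{jk}$ is nonzero, then $c_{jk}=1$ or $0<\ell<(j-1)c_{jk}$. **(B)** For $d\in\mathbb Z$, let $T_d=\{(x,y)\in\mathbb N^2\mid y<xd\}\cup\{(1,d)\}$ if $d\ge1$, and $T_d=\emptyset$ if $d\le0$. For all $(j,k),(p,q)\in I^{\rm im}$, $0\le\ell<j$, and $0\le m<p$: 1. $\Sigma(\alpha_{-1},\alpha_{-1})=\Sigma(\alpha_{-1},-\alpha_{-1})=\emptyset$. 2. $\Sigma(\alpha_{\ell,jk},\alpha_{-1})=\{(a\ell+b)\alpha_{-1}+a\alpha_{jk}\mid(a,b)\in T_{j-1-\ell}\}$ if $\ell<j-1$, and it is empty if $\ell=j-1$. 3. $\Sigma(\alpha_{\ell,jk},-\alpha_{-1})=\{(a\ell-b)\alpha_{-1}+a\alpha_{jk}\mid(a,b)\in T_{\ell}\}$ if $\ell>0$, and it is empty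 if $\ell=0$. 4. $\Sigma(\alpha_{\ell,jk},\alpha_{m,pq})=\{(a\ell+bm)\alpha_{-1}+a\alpha_{jk}+b\alpha_{pq}\mid a,b\in\mathbb N\}$, unless $(\ell,j,k)=(m,p,q)$ and $\ell\in\{0,j-1\}$, in which case it is empty. 5. If $(p,q)=(j,k)$ (so $0\le m<j$), then $\Sigma(\alpha_{\ell,jk},-\alpha_{m,jk})$ equals $\{\alpha_{-1}\}\cup\{(x\ell+y)\alpha_{-1}+x\alpha_{jk}\mid(x,y)\in T_{j-1-\ell}\}\cup\{-((xm-y)\alpha_{-1}+x\alpha_{jk})\mid(x,y)\in T_m\}$ if $\ell-m=1$; $\{-\alpha_{-1}\}\cup\{(x\ell-y)\alpha_{-1}+x\alpha_{jk}\mid(x,y)\in T_\ell\}\cup\{-((xm+y)\alpha_{-1}+x\alpha_{jk})\mid(x,y)\in T_{j-1-m}\}$ if $\ell-m=-1$; and $\emptyset$ otherwise. 6. $\Sigma(\alpha_{\ell,jk},-\alpha_{m,pq})=\emptyset$ if $(j,k)\ne(p,q)$. -/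

import Mathlib

noncomputable section

namespace MonsterLie

open scoped TensorProduct

/-! ### The coefficients `c(j)` of the normalized modular function `J` -/

/-- The `q`-expansion `1 + 240 ∑ σ₃(n) qⁿ` of the Eisenstein series `E₄`. -/
def eisensteinE4 : PowerSeries ℤ :=
  1 + 240 * PowerSeries.mk fun n => (ArithmeticFunction.sigma 3 n : ℤ)

/-- The power series `∏_{m ≥ 1} (1 - q ^ m)`; the coefficient of `q ^ n` only involves the factors
with `m ≤ n`. -/
def eulerProduct : PowerSeries ℤ :=
  PowerSeries.mk fun n =>
    PowerSeries.coeff n (∏ m ∈ Finset.range n, (1 - (PowerSeries.X : PowerSeries ℤ) ^ (m + 1)))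

/-- The power series `E₄³ / ∏ (1 - q ^ m) ^ 24`, that is, `q` times the modular function `j`. -/
def qTimesJ : PowerSeries ℤ :=
  eisensteinE4 ^ 3 * PowerSeries.invOfUnit (eulerProduct ^ 24) 1

/-- The `q`-expansion of the normalized modular function,
`J(q) = j(q) - 744 = q⁻¹ + 196884 q + ⋯`. -/
def modularJ : LaurentSeries ℤ :=
  HahnSeries.single (-1 : ℤ) (1 : ℤ) * HahnSeries.ofPowerSeries ℤ ℤ qTimesJ - HahnSeries.single 0 744

/-- `c(j)` is the coefficient of `q ^ j` in `J(q)`. -/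
def c (j : ℤ) : ℤ := modularJ.coeff j

theorem c_neg_one : c (-1) = 1 := by
  have h0 : PowerSeries.coeff 0 qTimesJ = 1 := by
    simp [qTimesJ, eisensteinE4, PowerSeries.constantCoeff_mk]
  have h1 : (HahnSeries.single (-1 : ℤ) (1 : ℤ) * HahnSeries.ofPowerSeries ℤ ℤ qTimesJ).coeff (-1)
      = 1 := by
    have h := HahnSeries.coeff_single_mul_add (r := (1 : ℤ))
      (x := HahnSeries.ofPowerSeries ℤ ℤ qTimesJ) (a := (0 : ℤ)) (b := (-1 : ℤ))
    have h2 := HahnSeries.ofPowerSeries_apply_coeff (Γ := ℤ) qTimesJ 0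
    simp only [Nat.cast_zero] at h2
    rw [h2, h0] at h
    simpa using h
  simp only [c, modularJ, HahnSeries.coeff_sub, h1]
  simp

/-! ### Index sets and the Borcherds Cartan matrix -/

/-- The index set `I = {(j, k) | j ∈ {-1, 1, 2, 3, …}, 1 ≤ k ≤ c(j)}`. -/
abbrev Index : Type :=
  {i : ℤ × ℤ // (i.1 = -1 ∨ 1 ≤ i.1) ∧ 1 ≤ i.2 ∧ i.2 ≤ c i.1}

/-- The first component `j` of an index `(j, k)`. -/
abbrev Index.deg (i : Index) : ℤ := i.1.1

/-- The index `(-1, 1)`. -/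
def reIndex : Index := ⟨(-1, 1), Or.inl rfl, le_refl _, by simp [c_neg_one]⟩

/-- The set `I^im` of the indices `(j, k)` with `j ∈ {1, 2, 3, …}`. -/
abbrev ImIndex : Type := {i : Index // 1 ≤ i.deg}

/-- The first component `j` of an index `(j, k) ∈ I^im`. -/
abbrev ImIndex.deg (i : ImIndex) : ℤ := i.1.deg

/-- The Borcherds Cartan matrix `a_{jk,pq} = -(j + p)`. -/
def cartan (i p : Index) : ℤ := -(i.deg + p.deg)

/-! ### The Lie algebra `𝔤(A)` -/

/-- The Serre--Chevalley generators. -/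
inductive Gen : Type
  | e : Index → Gen
  | f : Index → Gen
  | h : Index → Gen

/-- The free complex Lie algebra on the Serre--Chevalley generators. -/
abbrev FreeL : Type := FreeLieAlgebra ℂ Gen

/-- The generators `e_{jk}` of the free Lie algebra. -/
abbrev genE (i : Index) : FreeL := FreeLieAlgebra.of ℂ (Gen.e i)
/-- The generators `f_{jk}` of the free Lie algebra. -/
abbrev genF (i : Index) : FreeL := FreeLieAlgebra.of ℂ (Gen.f i)
/-- The generators `h_{jk}` of the free Lie algebra. -/
abbrev genH (i : Index) : FreeL := FreeLieAlgebra.of ℂ (Gen.h i)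

/-- The defining relators of `𝔤(A)`. -/
inductive Relator : FreeL → Prop
  | hh (i p : Index) : Relator ⁅genH i, genH p⁆
  | he (i p : Index) : Relator (⁅genH i, genE p⁆ - (cartan i p : ℂ) • genE p)
  | hf (i p : Index) : Relator (⁅genH i, genF p⁆ + (cartan i p : ℂ) • genF p)
  | ef_same (i : Index) : Relator (⁅genE i, genF i⁆ - genH i)
  | ef_ne (i p : Index) : i ≠ p → Relator ⁅genE i, genF p⁆
  | ee (i : Index) : 1 ≤ i.deg →
      Relator (((LieAlgebra.ad ℂ FreeL (genE reIndex)) ^ i.deg.toNat) (genE i))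
  | ff (i : Index) : 1 ≤ i.deg →
      Relator (((LieAlgebra.ad ℂ FreeL (genF reIndex)) ^ i.deg.toNat) (genF i))

/-- The ideal generated by the relators. -/
def relIdeal : LieIdeal ℂ FreeL := LieSubmodule.lieSpan ℂ FreeL {x | Relator x}

/-- The Lie algebra `𝔤(A)` associated with the Borcherds Cartan matrix `A`. -/
def LieA : Type := FreeL ⧸ relIdeal

instance : LieRing LieA := inferInstanceAs (LieRing (FreeL ⧸ relIdeal))
instance : LieAlgebra ℂ LieA := inferInstanceAs (LieAlgebra ℂ (FreeL ⧸ relIdeal))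

/-- The quotient map from the free Lie algebra onto `𝔤(A)`. -/
def quot : FreeL →ₗ⁅ℂ⁆ LieA where
  toFun x := (LieSubmodule.Quotient.mk x : FreeL ⧸ relIdeal)
  map_add' _ _ := rfl
  map_smul' _ _ := rfl
  map_lie' := rfl

theorem quot_surjective : Function.Surjective quot := Quot.mk_surjective

theorem quot_eq_zero {x : FreeL} : quot x = 0 ↔ x ∈ relIdeal :=
  LieSubmodule.Quotient.mk_eq_zero'

theorem quot_relator {x : FreeL} (hx : Relator x) : quot x = 0 :=
  quot_eq_zero.2 (LieSubmodule.subset_lieSpan hx)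

/-- The Serre--Chevalley generators `e_{jk}` of `𝔤(A)`. -/
def e (i : Index) : LieA := quot (genE i)
/-- The Serre--Chevalley generators `f_{jk}` of `𝔤(A)`. -/
def f (i : Index) : LieA := quot (genF i)
/-- The Serre--Chevalley generators `h_{jk}` of `𝔤(A)`. -/
def h (i : Index) : LieA := quot (genH i)

theorem lie_h_h (i p : Index) : ⁅h i, h p⁆ = 0 := by
  simpa [h] using quot_relator (Relator.hh i p)

theorem lie_h_e (i p : Index) : ⁅h i, e p⁆ = (cartan i p : ℂ) • e p := by
  have := quot_relator (Relator.he i p)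
  rw [map_sub, LieHom.map_lie, map_smul, sub_eq_zero] at this
  exact this

theorem lie_h_f (i p : Index) : ⁅h i, f p⁆ = -((cartan i p : ℂ) • f p) := by
  have := quot_relator (Relator.hf i p)
  rw [map_add, LieHom.map_lie, map_smul, add_eq_zero_iff_eq_neg] at this
  exact this

theorem lie_e_f_same (i : Index) : ⁅e i, f i⁆ = h i := by
  have := quot_relator (Relator.ef_same i)
  rw [map_sub, LieHom.map_lie, sub_eq_zero] at this
  exact this

theorem lie_e_f_ne {i p : Index} (hip : i ≠ p) : ⁅e i, f p⁆ = 0 := by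
  simpa [e, f] using quot_relator (Relator.ef_ne i p hip)

theorem map_ad_pow {L L' : Type} [LieRing L] [LieAlgebra ℂ L] [LieRing L'] [LieAlgebra ℂ L']
    (φ : L →ₗ⁅ℂ⁆ L') (n : ℕ) (x y : L) :
    φ (((LieAlgebra.ad ℂ L x) ^ n) y) = ((LieAlgebra.ad ℂ L' (φ x)) ^ n) (φ y) := by
  induction n with
  | zero => simp
  | succ n ih => simp only [pow_succ', Module.End.mul_apply, LieAlgebra.ad_apply, LieHom.map_lie, ih]

theorem ad_pow_e (i : Index) (hi : 1 ≤ i.deg) :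
    ((LieAlgebra.ad ℂ LieA (e reIndex)) ^ i.deg.toNat) (e i) = 0 := by
  have := quot_relator (Relator.ee i hi)
  rwa [map_ad_pow] at this

theorem ad_pow_f (i : Index) (hi : 1 ≤ i.deg) :
    ((LieAlgebra.ad ℂ LieA (f reIndex)) ^ i.deg.toNat) (f i) = 0 := by
  have := quot_relator (Relator.ff i hi)
  rwa [map_ad_pow] at this

/-- The universal property of the presentation of `𝔤(A)`. -/
def lift {L : Type} [LieRing L] [LieAlgebra ℂ L] (g : Gen → L)
    (hg : ∀ x, Relator x → FreeLieAlgebra.lift ℂ g x = 0) : LieA →ₗ⁅ℂ⁆ L :=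
  have hle : relIdeal ≤ (FreeLieAlgebra.lift ℂ g).ker :=
    LieSubmodule.lieSpan_le.2 fun x hx => LieHom.mem_ker.2 (hg x hx)
  { Submodule.liftQ (relIdeal : Submodule ℂ FreeL) (FreeLieAlgebra.lift ℂ g : FreeL →ₗ[ℂ] L)
      (fun x hx => LieHom.mem_ker.1 (hle hx)) with
    map_lie' := by
      intro x y
      obtain ⟨x, rfl⟩ := quot_surjective x
      obtain ⟨y, rfl⟩ := quot_surjective y
      exact LieHom.map_lie (FreeLieAlgebra.lift ℂ g) x y }

theorem lift_quot {L : Type} [LieRing L] [LieAlgebra ℂ L] (g : Gen → L)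
    (hg : ∀ x, Relator x → FreeLieAlgebra.lift ℂ g x = 0) (x : FreeL) :
    lift g hg (quot x) = FreeLieAlgebra.lift ℂ g x := rfl

/-- Homomorphisms out of `𝔤(A)` are determined by their values on the generators. -/
theorem hom_ext {L : Type} [LieRing L] [LieAlgebra ℂ L] {φ ψ : LieA →ₗ⁅ℂ⁆ L}
    (he : ∀ i, φ (e i) = ψ (e i)) (hf : ∀ i, φ (f i) = ψ (f i)) (hh : ∀ i, φ (h i) = ψ (h i)) :
    φ = ψ := by
  have : φ.comp quot = ψ.comp quot := by
    ext x
    cases x with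
    | e i => exact he i
    | f i => exact hf i
    | h i => exact hh i
  ext x
  obtain ⟨x, rfl⟩ := quot_surjective x
  exact LieHom.congr_fun this x

/-! ### The degree derivations -/

/-- The dual number `1 + t ε`. -/
def dual (t : ℂ) : DualNumber ℂ := 1 + t • DualNumber.eps

theorem dual_mul (s t : ℂ) : dual s * dual t = dual (s + t) := by
  ext <;> simp [dual, add_comm]

/-- The assignment `x ↦ (1 + w(x) ε) ⊗ x` on generators, where `w` is the weight. -/
def epsGen (w : Index → ℂ) : Gen → DualNumber ℂ ⊗[ℂ] LieA
  | .e i => dual (w i) ⊗ₜ e i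
  | .f i => dual (-w i) ⊗ₜ f i
  | .h i => dual 0 ⊗ₜ h i

theorem ad_pow_tmul (s t : ℂ) (x y : LieA) (n : ℕ) :
    ((LieAlgebra.ad ℂ (DualNumber ℂ ⊗[ℂ] LieA) (dual s ⊗ₜ x)) ^ n) (dual t ⊗ₜ y) =
      dual (n * s + t) ⊗ₜ[ℂ] ((LieAlgebra.ad ℂ LieA x) ^ n) y := by
  induction n with
  | zero => simp
  | succ n ih =>
    rw [pow_succ', Module.End.mul_apply, ih, LieAlgebra.ad_apply,
      LieAlgebra.ExtendScalars.bracket_tmul, dual_mul, pow_succ', Module.End.mul_apply,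
      LieAlgebra.ad_apply]
    congr 2
    push_cast
    ring

theorem epsGen_relator (w : Index → ℂ) (x : FreeL) (hx : Relator x) :
    FreeLieAlgebra.lift ℂ (epsGen w) x = 0 := by
  cases hx with
  | hh i p => simp [epsGen, lie_h_h]
  | he i p => simp [epsGen, lie_h_e, dual_mul]
  | hf i p => simp [epsGen, lie_h_f, dual_mul, TensorProduct.tmul_neg]
  | ef_same i => simp [epsGen, lie_e_f_same, dual_mul]
  | ef_ne i p hip => simp [epsGen, lie_e_f_ne hip]
  | ee i hi =>
    rw [map_ad_pow, FreeLieAlgebra.lift_of_apply, FreeLieAlgebra.lift_of_apply, epsGen, epsGen,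
      ad_pow_tmul, ad_pow_e i hi, TensorProduct.tmul_zero]
  | ff i hi =>
    rw [map_ad_pow, FreeLieAlgebra.lift_of_apply, FreeLieAlgebra.lift_of_apply, epsGen, epsGen,
      ad_pow_tmul, ad_pow_f i hi, TensorProduct.tmul_zero]

/-- The homomorphism `x ↦ x + ε D(x)`, where `D` is the derivation of weight `w`. -/
def epsHom (w : Index → ℂ) : LieA →ₗ⁅ℂ⁆ DualNumber ℂ ⊗[ℂ] LieA :=
  lift (epsGen w) (epsGen_relator w)

/-- The real part of `x + ε y`. -/
def rePart : DualNumber ℂ ⊗[ℂ] LieA →ₗ[ℂ] LieA :=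
  TensorProduct.lid ℂ LieA ∘ₗ LinearMap.rTensor LieA (TrivSqZeroExt.fstHom ℂ ℂ ℂ).toLinearMap

/-- The infinitesimal part of `x + ε y`. -/
def epsPart : DualNumber ℂ ⊗[ℂ] LieA →ₗ[ℂ] LieA :=
  TensorProduct.lid ℂ LieA ∘ₗ LinearMap.rTensor LieA (TrivSqZeroExt.sndHom ℂ ℂ)

@[simp] theorem rePart_tmul (a : DualNumber ℂ) (x : LieA) :
    rePart (a ⊗ₜ x) = TrivSqZeroExt.fst a • x := by simp [rePart]

@[simp] theorem epsPart_tmul (a : DualNumber ℂ) (x : LieA) :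
    epsPart (a ⊗ₜ x) = TrivSqZeroExt.snd a • x := by simp [epsPart]

theorem rePart_lie (X Y : DualNumber ℂ ⊗[ℂ] LieA) :
    rePart (LieAlgebra.ad ℂ (DualNumber ℂ ⊗[ℂ] LieA) X Y) = ⁅rePart X, rePart Y⁆ := by
  induction X with
  | zero => simp only [map_zero, LinearMap.zero_apply, zero_lie]
  | add X X' hX hX' => simp only [map_add, LinearMap.add_apply, add_lie, hX, hX']
  | tmul a x =>
    induction Y with
    | zero => simp only [map_zero, lie_zero]
    | add Y Y' hY hY' => simp only [map_add, lie_add, hY, hY']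
    | tmul b y =>
      rw [LieAlgebra.ad_apply, LieAlgebra.ExtendScalars.bracket_tmul]
      simp only [rePart_tmul, TrivSqZeroExt.fst_mul, smul_lie, lie_smul, mul_smul]
      rw [smul_comm]

theorem epsPart_lie (X Y : DualNumber ℂ ⊗[ℂ] LieA) :
    epsPart (LieAlgebra.ad ℂ (DualNumber ℂ ⊗[ℂ] LieA) X Y) =
      ⁅rePart X, epsPart Y⁆ - ⁅rePart Y, epsPart X⁆ := by
  induction X with
  | zero => simp only [map_zero, LinearMap.zero_apply, zero_lie, lie_zero, sub_zero]
  | add X X' hX hX' =>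
    simp only [map_add, LinearMap.add_apply, add_lie, lie_add, hX, hX']
    abel
  | tmul a x =>
    induction Y with
    | zero => simp only [map_zero, zero_lie, lie_zero, sub_zero]
    | add Y Y' hY hY' =>
      simp only [map_add, add_lie, lie_add, hY, hY']
      abel
    | tmul b y =>
      rw [LieAlgebra.ad_apply, LieAlgebra.ExtendScalars.bracket_tmul]
      simp only [rePart_tmul, epsPart_tmul, TrivSqZeroExt.snd_mul, smul_lie, lie_smul, add_smul]
      rw [← lie_skew x y]
      simp only [smul_neg, smul_smul, smul_eq_mul, op_smul_eq_smul]
      rw [mul_comm (TrivSqZeroExt.snd b), mul_comm (TrivSqZeroExt.snd a), sub_eq_add_neg]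

theorem rePart_epsHom (w : Index → ℂ) (x : LieA) : rePart (epsHom w x) = x := by
  let φ : LieA →ₗ⁅ℂ⁆ LieA :=
    { rePart ∘ₗ (epsHom w : LieA →ₗ[ℂ] DualNumber ℂ ⊗[ℂ] LieA) with
      map_lie' := by
        intro x y
        simpa using rePart_lie (epsHom w x) (epsHom w y) }
  have hφ : φ = LieHom.id := by
    refine hom_ext (fun i => ?_) (fun i => ?_) (fun i => ?_)
    · change rePart (FreeLieAlgebra.lift ℂ (epsGen w) (genE i)) = e i
      simp [epsGen, dual]
    · change rePart (FreeLieAlgebra.lift ℂ (epsGen w) (genF i)) = f i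
      simp [epsGen, dual]
    · change rePart (FreeLieAlgebra.lift ℂ (epsGen w) (genH i)) = h i
      simp [epsGen, dual]
  exact LieHom.congr_fun hφ x

/-- The derivation of `𝔤(A)` with `e_i ↦ w(i) e_i`, `f_i ↦ -w(i) f_i` and `h_i ↦ 0`. -/
def weightDer (w : Index → ℂ) : LieDerivation ℂ LieA LieA where
  toLinearMap := epsPart ∘ₗ (epsHom w : LieA →ₗ[ℂ] DualNumber ℂ ⊗[ℂ] LieA)
  leibniz' x y := by simpa [rePart_epsHom] using epsPart_lie (epsHom w x) (epsHom w y)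

theorem weightDer_e (w : Index → ℂ) (i : Index) : weightDer w (e i) = w i • e i := by
  change epsPart (FreeLieAlgebra.lift ℂ (epsGen w) (genE i)) = _
  simp [epsGen, dual]

theorem weightDer_f (w : Index → ℂ) (i : Index) : weightDer w (f i) = -w i • f i := by
  change epsPart (FreeLieAlgebra.lift ℂ (epsGen w) (genF i)) = _
  simp [epsGen, dual]

theorem weightDer_h (w : Index → ℂ) (i : Index) : weightDer w (h i) = 0 := by
  change epsPart (FreeLieAlgebra.lift ℂ (epsGen w) (genH i)) = _
  simp [epsGen, dual]

/-- The derivation `D_{jk}` of `𝔤(A)`, with `D_i(e_p) = δ_{ip} e_i`, `D_i(f_p) = -δ_{ip} f_i` and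
`D_i(h_p) = 0`. -/
def D (i : Index) : LieDerivation ℂ LieA LieA := weightDer (Pi.single i 1)

theorem lieSpan_generators :
    LieSubalgebra.lieSpan ℂ LieA (Set.range e ∪ Set.range f ∪ Set.range h) = ⊤ := by
  set S := LieSubalgebra.lieSpan ℂ LieA (Set.range e ∪ Set.range f ∪ Set.range h) with hS
  have hsub : ∀ x ∈ Set.range e ∪ Set.range f ∪ Set.range h, x ∈ S :=
    fun x hx => LieSubalgebra.subset_lieSpan hx
  let g : Gen → S
    | .e i => ⟨e i, hsub _ (Or.inl (Or.inl ⟨i, rfl⟩))⟩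
    | .f i => ⟨f i, hsub _ (Or.inl (Or.inr ⟨i, rfl⟩))⟩
    | .h i => ⟨h i, hsub _ (Or.inr ⟨i, rfl⟩)⟩
  have hg : S.incl.comp (FreeLieAlgebra.lift ℂ g) = quot := by
    ext x
    cases x <;> simp [g] <;> rfl
  rw [eq_top_iff]
  intro x _
  obtain ⟨x, rfl⟩ := quot_surjective x
  rw [← hg]
  exact (FreeLieAlgebra.lift ℂ g x).2

theorem lie_weightDer (w v : Index → ℂ) : ⁅weightDer w, weightDer v⁆ = 0 := by
  refine LieDerivation.ext_of_lieSpan_eq_top _ lieSpan_generators ?_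
  rintro x ((⟨i, rfl⟩ | ⟨i, rfl⟩) | ⟨i, rfl⟩)
  · simp [weightDer_e, smul_smul, mul_comm]
  · simp [weightDer_f, smul_smul, mul_comm]
  · simp [weightDer_h]

/-- The derivations `D_{jk}` for `(j, k) ∈ I - {(±1, 1)}`. -/
def extraDer : Set (LieDerivation ℂ LieA LieA) :=
  {d | ∃ i : Index, i.1 ≠ (-1, 1) ∧ i.1 ≠ (1, 1) ∧ d = D i}

theorem lie_extraDer {x y : LieDerivation ℂ LieA LieA} (hx : x ∈ Submodule.span ℂ extraDer)
    (hy : y ∈ Submodule.span ℂ extraDer) : ⁅x, y⁆ = 0 := by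
  induction hx using Submodule.span_induction with
  | zero => simp
  | add a b _ _ ha hb => rw [add_lie, ha, hb, add_zero]
  | smul t a _ ha => rw [smul_lie, ha, smul_zero]
  | mem a ha =>
    induction hy using Submodule.span_induction with
    | zero => simp
    | add b b' _ _ hb hb' => rw [lie_add, hb, hb', add_zero]
    | smul t b _ hb => rw [lie_smul, hb, smul_zero]
    | mem b hb =>
      obtain ⟨i, -, -, rfl⟩ := ha
      obtain ⟨p, -, -, rfl⟩ := hb
      exact lie_weightDer _ _

/-- The abelian Lie algebra `𝔡₀`, the span of the `D_{jk}` for `(j, k) ∈ I - {(±1, 1)}`. -/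
def d0 : LieSubalgebra ℂ (LieDerivation ℂ LieA LieA) :=
  { Submodule.span ℂ extraDer with
    lie_mem' := by
      intro x y hx hy
      have : ⁅x, y⁆ = 0 := lie_extraDer hx hy
      simp [this] }

/-! ### The extended Lie algebra, its Cartan subalgebra, roots -/

/-- The extended Lie algebra `𝔤ᵉ = 𝔡₀ ⋉ 𝔤(A)`. -/
abbrev LieAe : Type := LieAlgebra.SemiDirectSum LieA d0 d0.incl

/-- The inclusion of `𝔤(A)` into `𝔤ᵉ`. -/
abbrev incl : LieA →ₗ⁅ℂ⁆ LieAe := LieAlgebra.SemiDirectSum.inl d0.incl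

/-- The Cartan subalgebra `𝔥_A` of `𝔤(A)`, the span of the `h_{jk}`. -/
def hA : Submodule ℂ LieA := Submodule.span ℂ (Set.range h)

/-- The Cartan subalgebra `𝔥ᵉ = 𝔡₀ ⊕ 𝔥_A` of `𝔤ᵉ`. -/
def he : Submodule ℂ LieAe := hA.comap (LieAlgebra.SemiDirectSum.projl d0.incl)

/-- The root space `{x ∈ 𝔤(A) | [h, x] = α(h) x for all h ∈ 𝔥ᵉ}`; brackets are taken in `𝔤ᵉ`. -/
def rootSpace (α : Module.Dual ℂ he) : Set LieA :=
  {x | ∀ t : he, ⁅(t : LieAe), incl x⁆ = incl (α t • x)}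

/-- The root system `Δ`: the nonzero `α ∈ (𝔥ᵉ)*` whose root space is nonzero. -/
def roots : Set (Module.Dual ℂ he) := {α | α ≠ 0 ∧ ∃ x ∈ rootSpace α, x ≠ 0}

theorem exists_lie_he_e (i : Index) (t : he) :
    ∃ s : ℂ, ⁅(t : LieAe), incl (e i)⁆ = incl (s • e i) := by
  obtain ⟨⟨x, d⟩, hx⟩ := t
  have h1 : ∃ s : ℂ, ⁅x, e i⁆ = s • e i := by
    have hx' : x ∈ Submodule.span ℂ (Set.range h) := hx
    clear hx
    induction hx' using Submodule.span_induction with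
    | zero => exact ⟨0, by simp⟩
    | add a b _ _ ha hb =>
      obtain ⟨r, hr⟩ := ha
      obtain ⟨s, hs⟩ := hb
      exact ⟨r + s, by rw [add_lie, hr, hs, add_smul]⟩
    | smul r a _ ha =>
      obtain ⟨s, hs⟩ := ha
      exact ⟨r * s, by rw [smul_lie, hs, mul_smul]⟩
    | mem a ha =>
      obtain ⟨p, rfl⟩ := ha
      exact ⟨_, lie_h_e p i⟩
  have h2 : ∃ s : ℂ, (d : LieDerivation ℂ LieA LieA) (e i) = s • e i := by
    obtain ⟨d, hd⟩ := d
    have hd' : d ∈ Submodule.span ℂ extraDer := hd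
    change ∃ s : ℂ, d (e i) = s • e i
    clear hd hx h1
    induction hd' using Submodule.span_induction with
    | zero => exact ⟨0, by simp⟩
    | add a b _ _ ha hb =>
      obtain ⟨r, hr⟩ := ha
      obtain ⟨s, hs⟩ := hb
      exact ⟨r + s, by rw [LieDerivation.add_apply, hr, hs, add_smul]⟩
    | smul r a _ ha =>
      obtain ⟨s, hs⟩ := ha
      exact ⟨r * s, by rw [LieDerivation.smul_apply, hs, mul_smul]⟩
    | mem a ha =>
      obtain ⟨p, -, -, rfl⟩ := ha
      exact ⟨_, weightDer_e _ i⟩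
  obtain ⟨r, hr⟩ := h1
  obtain ⟨s, hs⟩ := h2
  exact ⟨r + s, by simp [hr, hs, add_smul]⟩

theorem exists_simpleRoot (i : Index) : ∃ α : Module.Dual ℂ he, e i ∈ rootSpace α := by
  by_cases hi : e i = 0
  · exact ⟨0, fun t => by rw [hi, smul_zero, map_zero, lie_zero]⟩
  choose s hs using exists_lie_he_e i
  have hinj : ∀ a b : ℂ, incl (a • e i) = incl (b • e i) → a = b := fun a b hab =>
    smul_left_injective ℂ hi (LieAlgebra.SemiDirectSum.inl_injective d0.incl hab)
  refine ⟨{ toFun := s, map_add' := fun t u => ?_, map_smul' := fun r t => ?_ }, fun t => hs t⟩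
  · refine hinj _ _ ?_
    rw [add_smul, map_add, ← hs, ← hs, ← hs, Submodule.coe_add, add_lie]
  · refine hinj _ _ ?_
    have h3 : incl (r • s t • e i) = r • incl (s t • e i) := map_smul incl r _
    rw [RingHom.id_apply, smul_eq_mul, mul_smul, h3, ← hs, ← hs, Submodule.coe_smul, smul_lie]

/-- The simple root `α_{jk} ∈ (𝔥ᵉ)*`, given by `[h, e_{jk}] = α_{jk}(h) e_{jk}` for all
`h ∈ 𝔥ᵉ`. (It is unique because `e_{jk} ≠ 0`.) -/
def simpleRoot (i : Index) : Module.Dual ℂ he := (exists_simpleRoot i).choose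

theorem simpleRoot_spec (i : Index) (t : he) :
    ⁅(t : LieAe), incl (e i)⁆ = incl (simpleRoot i t • e i) :=
  (exists_simpleRoot i).choose_spec t

/-- The element `∑ a_{jk} α_{jk}` of the root lattice `Q ≅ ℤ^I`. -/
def latticeElt (a : Index →₀ ℤ) : Module.Dual ℂ he := a.sum fun i n => n • simpleRoot i

/-- The bilinear form on `Q` with `(α_{jk}, α_{pq}) = a_{jk,pq}`, in coordinates. -/
def latticeForm (a b : Index →₀ ℤ) : ℤ := a.sum fun i m => b.sum fun p n => m * n * cartan i p

/-- The positive roots `Δ₊`: the roots with nonnegative coefficients in the simple roots. -/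
def positiveRoots : Set (Module.Dual ℂ he) :=
  {α ∈ roots | ∃ a : Index →₀ ℤ, α = latticeElt a ∧ ∀ i, 0 ≤ a i}

/-- The imaginary roots `Δ^im`: the roots with `(α, α) ≤ 0`. -/
def imaginaryRoots : Set (Module.Dual ℂ he) :=
  {α ∈ roots | ∃ a : Index →₀ ℤ, α = latticeElt a ∧ latticeForm a a ≤ 0}

/-- The sets `Σ_1, Σ_2, …` (indexed from `0`) in the definition of the root span. -/
def rootSpanStep {V : Type*} [AddCommGroup V] (Δ : Set V) (α β : V) : ℕ → Set V
  | 0 => {α + β} ∩ Δ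
  | n + 1 => {x | ∃ γ ∈ rootSpanStep Δ α β n, x = γ + α ∨ x = γ + β} ∩ Δ

/-- The root span `Σ(α, β)` in a set of roots `Δ`. -/
def rootSpan {V : Type*} [AddCommGroup V] (Δ : Set V) (α β : V) : Set V :=
  ⋃ n, rootSpanStep Δ α β n

/-- The real simple root `α_{-1}`. -/
def αre : Module.Dual ℂ he := simpleRoot reIndex

/-- The simple root `α_{jk}` for `(j, k) ∈ I^im`. -/
def αim (i : ImIndex) : Module.Dual ℂ he := simpleRoot i.1

/-- `α_{ℓ,jk} = ℓ α_{-1} + α_{jk}`. -/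
def αext (l : ℤ) (i : ImIndex) : Module.Dual ℂ he := l • αre + αim i

/-- The root span `Σ(α, β)` in the root system `Δ` of `𝔤(A)`. -/
def Sig (α β : Module.Dual ℂ he) : Set (Module.Dual ℂ he) := rootSpan roots α β

end MonsterLie
end

/-! Call the vectors `x_{ℓ,i} = (ad e_{-1})^ℓ e_i` with `0 ≤ ℓ < deg i` letters, and let `n⁺` be the
subalgebra they generate. The proof determines the weights of `n⁺` exactly and reads both parts of
the theorem off the answer.

Upper bound. `𝔤(A)` is spanned by `n⁺`, its image under the Chevalley involution, and `e_{-1}`,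
`f_{-1}`, `h_{jk}` (`exists_triangular`). A weight of `n⁺` is a sum of weights of letters, and `[x,
x] = 0` removes the multisets consisting of at least two copies of one letter. Since weight spaces
are independent and the simple roots are linearly independent on `𝔥ᵉ`, every root is `±α_{-1}` or,
up to sign, the weight of one letter or of a multiset with two different letters.

Lower bound. `𝔤(A)` acts on the tensor algebra over the letters: `x_{ℓ,i}` is left multiplication,
and the other generators are fixed by killing the empty word and by their commutators with letters
(`rep`). Applying `u ∈ n⁺` to the empty word turns brackets into commutators of tensors, so it
suffices to find, for each multiset with two different letters, a bracket in which some word has a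
nonzero coefficient (`exists_word_mixed`).

Numerics. With the imaginary part `c ≥ 0` fixed, the exponents `ℓ` of the letters can be raised one
at a time, so their sum takes every value from `0` to `∑ (j - 1) c_{jk}`. A constant multiset with
at least two elements can be made mixed by moving one exponent up and another down, except when all
exponents are `0` or all are `j - 1`; this is condition (iii). The form factors as `(a, a) = -2 (∑
a_i) (∑ deg(i) a_i)`, which gives the sign.

Root spans. Every element of `Σ(α, β)` is a root `aα + bβ` with `a, b ≥ 1`. Conversely such a root
is reached by first adding one of `α`, `β` repeatedly and then the other, provided the path stays in
`Δ`; the inequalities for roots show that it does in every case needed. -/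

noncomputable section

namespace MonsterLie

/-! ### Operators on the tensor space -/

section TensorOperators

variable {X : Type}

/-- The tensor space with basis the words in the alphabet `X`. -/
abbrev WordSpace (X : Type) : Type := List X →₀ ℂ

/-- The Lie algebra of linear operators on `WordSpace X`. -/
def Op (X : Type) : Type := Module.End ℂ (WordSpace X)

instance : LieRing (Op X) := LieRing.ofAssociativeRing (A := Module.End ℂ (WordSpace X))
instance : LieAlgebra ℂ (Op X) :=
  LieAlgebra.ofAssociativeAlgebra (R := ℂ) (A := Module.End ℂ (WordSpace X))

/-- The action of operators on `WordSpace X`. -/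
def act : Op X →ₗ[ℂ] WordSpace X →ₗ[ℂ] WordSpace X where
  toFun D := D
  map_add' _ _ := rfl
  map_smul' _ _ := rfl

theorem act_lie (D D' : Op X) (w : WordSpace X) :
    act ⁅D, D'⁆ w = act D (act D' w) - act D' (act D w) := rfl

/-- The empty word. -/
def vac : WordSpace X := Finsupp.single [] 1

/-- Left multiplication by a letter. -/
def consOp (x : X) : Op X := Finsupp.lmapDomain ℂ ℂ (List.cons x)

/-- Right multiplication by a word. -/
def appendOp (w : List X) : WordSpace X →ₗ[ℂ] WordSpace X := Finsupp.lmapDomain ℂ ℂ (· ++ w)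

theorem act_consOp (x : X) (u : WordSpace X) :
    act (consOp x) u = Finsupp.mapDomain (List.cons x) u := rfl

theorem act_consOp_single (x : X) (w : List X) :
    act (consOp x) (Finsupp.single w 1) = Finsupp.single (x :: w) 1 := by
  simp [act_consOp]

theorem appendOp_single (v w : List X) :
    appendOp w (Finsupp.single v 1) = Finsupp.single (v ++ w) 1 := by
  simp [appendOp]

theorem wordSpace_ext {D D' : WordSpace X →ₗ[ℂ] WordSpace X}
    (h : ∀ w, D (Finsupp.single w 1) = D' (Finsupp.single w 1)) : D = D' :=
  Finsupp.lhom_ext' fun w => LinearMap.ext_ring (h w)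

/-- Left and right multiplication commute. This is what later identifies the action of `n⁺` with
left multiplication by tensors. -/
theorem consOp_appendOp (x : X) (w : List X) (u : WordSpace X) :
    act (consOp x) (appendOp w u) = appendOp w (act (consOp x) u) :=
  LinearMap.congr_fun (f := act (consOp x) ∘ₗ appendOp w) (g := appendOp w ∘ₗ act (consOp x))
    (wordSpace_ext fun v => by
      simp only [LinearMap.comp_apply, act_consOp_single, appendOp_single, List.cons_append]) u

/-- The value on words of the operator with prescribed commutators with the letters. -/
def commVal (φ : X → Op X) : List X → WordSpace X
  | [] => 0
  | x :: w => act (φ x) (Finsupp.single w 1) + act (consOp x) (commVal φ w)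

/-- The operator annihilating the empty word with prescribed commutators with the letters. -/
def commOp (φ : X → Op X) : Op X := Finsupp.lift (WordSpace X) ℂ (List X) (commVal φ)

theorem act_commOp_single (φ : X → Op X) (w : List X) :
    act (commOp φ) (Finsupp.single w 1) = commVal φ w := by
  change Finsupp.lift (WordSpace X) ℂ (List X) (commVal φ) (Finsupp.single w 1) = _
  simp

theorem act_commOp_vac (φ : X → Op X) : act (commOp φ) vac = 0 := by
  rw [vac, act_commOp_single, commVal]

theorem lie_commOp_consOp (φ : X → Op X) (x : X) : ⁅commOp φ, consOp x⁆ = φ x :=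
  wordSpace_ext (D := act ⁅commOp φ, consOp x⁆) (D' := act (φ x)) fun w => by
    rw [act_lie, act_consOp_single, act_commOp_single, act_commOp_single, commVal,
      add_sub_cancel_right]

/-- Letters build every word from the empty one, so an operator is known from its value there and
its commutators with letters. The relations among the operators are mostly verified in this way, via
the Jacobi identity. -/
theorem op_ext {D D' : Op X} (h0 : act D vac = act D' vac)
    (h : ∀ x : X, ⁅D, consOp x⁆ = ⁅D', consOp x⁆) : D = D' := by
  refine wordSpace_ext (D := act D) (D' := act D') fun w => ?_
  induction w with
  | nil => exact h0
  | cons x w ih =>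
    have h1 := congrArg (fun A : Op X => act A (Finsupp.single w 1)) (h x)
    simpa only [act_lie, act_consOp_single, ih, sub_left_inj] using h1

end TensorOperators

/-! ### The representation of `𝔤(A)` on words -/

/-- `c(-1) = 1` leaves only one index of degree `-1`. No other value of `c` enters the proof. -/
theorem deg_cases (i : Index) : i = reIndex ∨ 1 ≤ i.deg := by
  obtain ⟨⟨j, k⟩, hj, hk, hk'⟩ := i
  rcases hj with hj | hj
  · left
    simp only at hj hk hk'
    subst hj
    rw [c_neg_one] at hk'
    have : k = 1 := le_antisymm hk' hk
    subst this
    rfl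
  · exact Or.inr hj

theorem reIndex_deg : reIndex.deg = -1 := rfl

theorem ImIndex.ne_reIndex (i : ImIndex) : i.1 ≠ reIndex := by
  intro h
  have := i.2
  rw [h, reIndex_deg] at this
  omega

/-- The letters: pairs `(i, ℓ)` with `0 ≤ ℓ < deg i`. -/
abbrev Letter : Type := {x : ImIndex × ℕ // (x.2 : ℤ) < x.1.deg}

/-- Left multiplication by the letter `(i, ℓ)`, extended by zero to all `ℓ`. -/
def opX (l : ℕ) (i : ImIndex) : Op Letter :=
  if h : (l : ℤ) < i.deg then consOp ⟨(i, l), h⟩ else 0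

theorem opX_eq_zero {l : ℕ} {i : ImIndex} (h : i.deg ≤ l) : opX l i = 0 := dif_neg (not_lt.2 h)

theorem opX_eq_consOp (x : Letter) : opX x.1.2 x.1.1 = consOp x := dif_pos x.2

theorem opX_ext {D D' : Op Letter} (h0 : act D vac = act D' vac)
    (h : ∀ l i, ⁅D, opX l i⁆ = ⁅D', opX l i⁆) : D = D' :=
  op_ext h0 fun x => by rw [← opX_eq_consOp]; exact h _ _

/-- Extending letters by zero to all `ℓ` avoids carrying the bound `ℓ < deg i` through computations;
the price is that the prescribed commutators must vanish beyond the bound as well. -/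
theorem commOp_opX (φ : ℕ → ImIndex → Op Letter)
    (hφ : ∀ (l : ℕ) (i : ImIndex), i.deg ≤ l → φ l i = 0) (l : ℕ) (i : ImIndex) :
    ⁅commOp (fun x : Letter => φ x.1.2 x.1.1), opX l i⁆ = φ l i := by
  by_cases h : (l : ℤ) < i.deg
  · rw [opX, dif_pos h, lie_commOp_consOp]
  · rw [opX_eq_zero (not_lt.1 h), lie_zero, hφ l i (not_lt.1 h)]

/-- The action of `e_{-1}`. -/
def opE : Op Letter := commOp fun x => opX (x.1.2 + 1) x.1.1

/-- The action of `f_{-1}`. -/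
def opF : Op Letter :=
  commOp fun x => ((x.1.2 : ℂ) * (x.1.1.deg - x.1.2)) • opX (x.1.2 - 1) x.1.1

/-- The action of `h_p`. -/
def opH (p : Index) : Op Letter :=
  commOp fun x => ((cartan p reIndex : ℂ) * x.1.2 + cartan p x.1.1.1) • opX x.1.2 x.1.1

open Classical in
/-- The commutator of the action of `f_p` with the letter `(i, ℓ)`. -/
def opFimVal (p : ImIndex) (l : ℕ) (i : ImIndex) : Op Letter :=
  if i = p then (if l = 0 then -opH p.1 else if l = 1 then (cartan p.1 reIndex : ℂ) • opE else 0)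
  else 0

/-- The action of `f_p` for `p` imaginary. -/
def opFim (p : ImIndex) : Op Letter :=
  commOp fun x => opFimVal p x.1.2 x.1.1

theorem opE_opX (l : ℕ) (i : ImIndex) : ⁅opE, opX l i⁆ = opX (l + 1) i :=
  commOp_opX (fun l i => opX (l + 1) i)
    (fun l i h => opX_eq_zero (by push_cast; omega)) l i

theorem opF_opX (l : ℕ) (i : ImIndex) :
    ⁅opF, opX l i⁆ = ((l : ℂ) * (i.deg - l)) • opX (l - 1) i := by
  refine commOp_opX (fun l i => ((l : ℂ) * (i.deg - l)) • opX (l - 1) i) (fun l i h => ?_) l i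
  -- At `l = deg i` the letter `l - 1` still exists, and it is the factor `deg i - l` that vanishes.
  rcases h.eq_or_lt with h | h
  · simp [h]
  · rw [opX_eq_zero (by omega), smul_zero]

theorem opH_opX (p : Index) (l : ℕ) (i : ImIndex) :
    ⁅opH p, opX l i⁆ = ((cartan p reIndex : ℂ) * l + cartan p i.1) • opX l i :=
  commOp_opX (fun l i => ((cartan p reIndex : ℂ) * l + cartan p i.1) • opX l i)
    (fun l i h => by rw [opX_eq_zero h, smul_zero]) l i

theorem opFim_opX (p : ImIndex) (l : ℕ) (i : ImIndex) :
    ⁅opFim p, opX l i⁆ = opFimVal p l i := by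
  refine commOp_opX (opFimVal p) (fun l i h => ?_) l i
  have hi := i.2
  change 1 ≤ i.deg at hi
  rw [opFimVal]
  split_ifs with h1 h2 h3
  · omega
  -- Here `l = 1` is out of range, so `deg i = 1` and the Cartan entry with `α_{-1}` is `0`.
  · subst h3 h1
    have : cartan i.1 reIndex = 0 := by
      change -(i.deg + -1) = 0
      push_cast at h
      omega
    rw [this, Int.cast_zero, zero_smul]
  · rfl
  · rfl

theorem opFimVal_zero_self (p : ImIndex) : opFimVal p 0 p = -opH p.1 := by simp [opFimVal]
theorem opFimVal_one_self (p : ImIndex) :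
    opFimVal p 1 p = (cartan p.1 reIndex : ℂ) • opE := by simp [opFimVal]
theorem opFimVal_two (p i : ImIndex) (l : ℕ) : opFimVal p (l + 2) i = 0 := by simp [opFimVal]
theorem opFimVal_ne {p i : ImIndex} (h : i ≠ p) (l : ℕ) : opFimVal p l i = 0 := by
  simp [opFimVal, h]

theorem opE_vac : act opE vac = 0 := act_commOp_vac _
theorem opF_vac : act opF vac = 0 := act_commOp_vac _
theorem opH_vac (p : Index) : act (opH p) vac = 0 := act_commOp_vac _
theorem opFim_vac (p : ImIndex) : act (opFim p) vac = 0 := act_commOp_vac _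

theorem lie_vac {D D' : Op Letter} (h : act D vac = 0) (h' : act D' vac = 0) :
    act ⁅D, D'⁆ vac = 0 := by
  rw [act_lie, h, h', map_zero, map_zero, sub_zero]

/-! ### Commutation relations of the operators -/

theorem cartan_comm (i p : Index) : cartan i p = cartan p i := by
  simp only [cartan, add_comm]

theorem opH_opH (p q : Index) : ⁅opH p, opH q⁆ = 0 := by
  refine opX_ext (by
    rw [lie_vac (opH_vac p) (opH_vac q), map_zero, LinearMap.zero_apply])
    fun l i => ?_
  rw [lie_lie, opH_opX, opH_opX, lie_smul, lie_smul, opH_opX, opH_opX, smul_comm, sub_self,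
    zero_lie]

theorem opH_opE (p : Index) : ⁅opH p, opE⁆ = (cartan p reIndex : ℂ) • opE := by
  refine opX_ext (by
    rw [lie_vac (opH_vac p) opE_vac, map_smul, LinearMap.smul_apply, opE_vac, smul_zero])
    fun l i => ?_
  rw [lie_lie, opH_opX, opE_opX, lie_smul, smul_lie, opE_opX, opH_opX, ← sub_smul]
  congr 1
  push_cast
  ring

theorem opH_opF (p : Index) : ⁅opH p, opF⁆ = -((cartan p reIndex : ℂ) • opF) := by
  refine opX_ext (by
    rw [lie_vac (opH_vac p) opF_vac, map_neg, map_smul, LinearMap.neg_apply,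
      LinearMap.smul_apply,
    opF_vac, smul_zero, neg_zero]) fun l i => ?_
  rw [lie_lie, opH_opX, opF_opX, lie_smul, lie_smul, neg_lie, smul_lie, opF_opX, opH_opX]
  simp only [smul_smul, ← sub_smul, ← neg_smul]
  rcases l with _ | l
  · simp
  · congr 1
    simp only [Nat.add_sub_cancel]
    push_cast
    ring

/-- With `d = deg i` this is `l(d - l) - (l + 1)(d - l - 1) = 2l + 1 - d`: the letters over `i` form
the `d`-dimensional irreducible `𝔰𝔩₂`-module. -/
theorem opE_opF : ⁅opE, opF⁆ = opH reIndex := by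
  refine opX_ext (by rw [lie_vac opE_vac opF_vac, opH_vac]) fun l i => ?_
  rw [lie_lie, opH_opX, opF_opX, opE_opX, lie_smul, opF_opX, opE_opX]
  have h1 : cartan reIndex reIndex = 2 := rfl
  have h2 : cartan reIndex i.1 = 1 - i.deg := by
    change -(-1 + i.deg) = 1 - i.deg
    ring
  rw [h1, h2]
  rcases l with _ | l
  · simp only [Nat.cast_zero, zero_mul, zero_smul, zero_sub, zero_add, Nat.cast_one, one_mul,
      Nat.sub_self, ← neg_smul]
    congr 1
    push_cast
    ring
  · simp only [Nat.add_sub_cancel, ← sub_smul]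
    congr 1
    push_cast
    ring

theorem opH_opFim (q : Index) (p : ImIndex) :
    ⁅opH q, opFim p⁆ = -((cartan q p.1 : ℂ) • opFim p) := by
  refine opX_ext (by rw [lie_vac (opH_vac q) (opFim_vac p), map_neg, map_smul,
    LinearMap.neg_apply, LinearMap.smul_apply, opFim_vac, smul_zero, neg_zero]) fun l i => ?_
  rw [lie_lie, opH_opX, lie_smul, neg_lie, smul_lie, opFim_opX]
  by_cases hip : i = p
  · subst hip
    rcases l with _ | _ | l
    · rw [opFimVal_zero_self, lie_neg, opH_opH, ← neg_smul, neg_zero, zero_sub, ← neg_smul]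
      simp
    · rw [opFimVal_one_self, lie_smul, opH_opE, ← neg_smul]
      simp only [smul_smul, ← sub_smul]
      congr 1
      push_cast
      ring
    · simp [opFimVal_two]
  · simp [opFimVal_ne hip]

/-- This relation dictates `opFimVal`: starting from `-h_p` at `ℓ = 0`, bracketing with `e_{-1}`
gives a multiple of `e_{-1}` at `ℓ = 1`, and then `0`. -/
theorem opE_opFim (p : ImIndex) : ⁅opE, opFim p⁆ = 0 := by
  refine opX_ext (by
    rw [lie_vac opE_vac (opFim_vac p), map_zero, LinearMap.zero_apply])
    fun l i => ?_
  rw [lie_lie, opE_opX, zero_lie, opFim_opX, opFim_opX]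
  by_cases hip : i = p
  · subst hip
    rcases l with _ | _ | l
    · rw [opFimVal_zero_self, opFimVal_one_self, lie_neg, ← lie_skew, opH_opE, neg_neg, sub_self]
    · rw [opFimVal_one_self, opFimVal_two, lie_smul, lie_self, smul_zero, sub_zero]
    · rw [opFimVal_two, show l + 2 + 1 = (l + 1) + 2 from rfl, opFimVal_two, lie_zero, sub_zero]
  · simp [opFimVal_ne hip]

theorem opX_opF_zero (i : ImIndex) : ⁅opX 0 i, opF⁆ = 0 := by
  rw [← lie_skew, opF_opX]
  simp

theorem opX_opFim_self (i : ImIndex) : ⁅opX 0 i, opFim i⁆ = opH i.1 := by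
  rw [← lie_skew, opFim_opX, opFimVal_zero_self, neg_neg]

theorem opX_opFim_ne {i p : ImIndex} (h : i ≠ p) : ⁅opX 0 i, opFim p⁆ = 0 := by
  rw [← lie_skew, opFim_opX, opFimVal_ne h, neg_zero]

/-! ### The Serre relations for the operators -/

theorem ad_opE_pow (n : ℕ) (i : ImIndex) :
    ((LieAlgebra.ad ℂ (Op Letter) opE) ^ n) (opX 0 i) = opX n i := by
  induction n with
  | zero => rfl
  | succ n ih => rw [pow_succ', Module.End.mul_apply, ih, LieAlgebra.ad_apply, opE_opX]

/-- The vectors `(ad f_{-1})ⁿ f_i`. -/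
def opY (i : ImIndex) (n : ℕ) : Op Letter :=
  ((LieAlgebra.ad ℂ (Op Letter) opF) ^ n) (opFim i)

theorem opY_succ (i : ImIndex) (n : ℕ) : opY i (n + 1) = ⁅opF, opY i n⁆ := by
  rw [opY, pow_succ', Module.End.mul_apply, LieAlgebra.ad_apply, opY]

theorem opY_vac (i : ImIndex) (n : ℕ) : act (opY i n) vac = 0 := by
  induction n with
  | zero => exact opFim_vac i
  | succ n ih => rw [opY_succ, lie_vac opF_vac ih]

theorem opH_opY (q : Index) (i : ImIndex) (n : ℕ) :
    ⁅opH q, opY i n⁆ = (-((cartan q reIndex : ℂ) * n + cartan q i.1)) • opY i n := by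
  induction n with
  | zero =>
    rw [show opY i 0 = opFim i from rfl, opH_opFim, ← neg_smul]
    simp
  | succ n ih =>
    rw [opY_succ, leibniz_lie, ih, opH_opF, neg_lie, smul_lie, lie_smul, ← neg_smul, ← add_smul]
    congr 1
    push_cast
    ring

/-- `f_i` is a highest weight vector of weight `deg i - 1` for the `𝔰𝔩₂` of `e_{-1}`, `f_{-1}`; the
scalar vanishes when `n + 1 = deg i`. -/
theorem opE_opY (i : ImIndex) (n : ℕ) :
    ⁅opE, opY i (n + 1)⁆ = (((n : ℂ) + 1) * (i.deg - 1 - n)) • opY i n := by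
  induction n with
  | zero =>
    rw [opY_succ, leibniz_lie, opE_opF, opH_opY, show opY i 0 = opFim i from rfl, opE_opFim,
      lie_zero, add_zero, cartan_comm reIndex i.1]
    rw [show cartan i.1 reIndex = -(i.deg + -1) from rfl]
    congr 1
    push_cast
    ring
  | succ n ih =>
    rw [opY_succ i (n + 1), leibniz_lie, opE_opF, opH_opY, ih, lie_smul, ← opY_succ, ← add_smul,
      cartan_comm reIndex i.1]
    rw [show cartan i.1 reIndex = -(i.deg + -1) from rfl,
      show cartan reIndex reIndex = 2 from rfl]
    congr 1
    push_cast
    ring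

theorem opX_opY_ne {i p : ImIndex} (h : p ≠ i) (n : ℕ) : ⁅opX 0 p, opY i n⁆ = 0 := by
  induction n with
  | zero => exact opX_opFim_ne h
  | succ n ih => rw [opY_succ, leibniz_lie, opX_opF_zero, ih, zero_lie, lie_zero, add_zero]

theorem opX_opY_one (i : ImIndex) :
    ⁅opX 0 i, opY i 1⁆ = (cartan i.1 reIndex : ℂ) • opF := by
  rw [opY_succ, leibniz_lie, opX_opF_zero, zero_lie, zero_add, show opY i 0 = opFim i from rfl,
    opX_opFim_self, ← lie_skew, opH_opF, neg_neg]

theorem opX_opY_two (i : ImIndex) (n : ℕ) : ⁅opX 0 i, opY i (n + 2)⁆ = 0 := by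
  induction n with
  | zero =>
    rw [opY_succ, leibniz_lie, opX_opF_zero, zero_lie, zero_add, opX_opY_one, lie_smul, lie_self,
      smul_zero]
  | succ n ih =>
    rw [show n + 1 + 2 = (n + 2) + 1 from rfl, opY_succ, leibniz_lie, opX_opF_zero, ih, zero_lie,
      lie_zero, add_zero]

theorem opX_opY_deg (p i : ImIndex) : ⁅opX 0 p, opY i i.deg.toNat⁆ = 0 := by
  have hi := i.2
  change 1 ≤ i.deg at hi
  by_cases h : p = i
  · subst h
    obtain ⟨n, hn⟩ : ∃ n : ℕ, p.deg.toNat = n + 1 := ⟨p.deg.toNat - 1, by omega⟩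
    rw [hn]
    -- In degree `1` the bracket is a multiple of `f_{-1}` with Cartan entry `0` as coefficient; in
    -- higher degree `f_i` has been lowered at least twice.
    rcases n with _ | n
    · have : cartan p.1 reIndex = 0 := by
        change -(p.deg + -1) = 0
        omega
      rw [opX_opY_one, this, Int.cast_zero, zero_smul]
    · exact opX_opY_two p n
  · exact opX_opY_ne h _

theorem opE_opY_deg (i : ImIndex) : ⁅opE, opY i i.deg.toNat⁆ = 0 := by
  have hi := i.2
  change 1 ≤ i.deg at hi
  obtain ⟨n, hn⟩ : ∃ n : ℕ, i.deg = n + 1 := ⟨i.deg.toNat - 1, by omega⟩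
  have hn' : i.deg.toNat = n + 1 := by omega
  rw [hn', opE_opY, hn]
  simp

/-- The operator kills the empty word and commutes with `opE` and with every `opX 0 p`, hence with
every letter `(ad opE)^l (opX 0 p)`. -/
theorem opY_deg (i : ImIndex) : opY i i.deg.toNat = 0 := by
  refine opX_ext (by rw [opY_vac, map_zero, LinearMap.zero_apply]) fun l p => ?_
  rw [zero_lie, ← lie_skew, neg_eq_zero]
  induction l with
  | zero => exact opX_opY_deg p i
  | succ l ih => rw [← opE_opX, lie_lie, ih, opE_opY_deg, lie_zero, lie_zero, sub_zero]

open Classical in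
/-- The action of the generators on words. -/
def repGen : Gen → Op Letter
  | .e i => if h : 1 ≤ i.deg then opX 0 ⟨i, h⟩ else opE
  | .f i => if h : 1 ≤ i.deg then opFim ⟨i, h⟩ else opF
  | .h i => opH i

theorem repGen_e_re : repGen (.e reIndex) = opE := by
  rw [repGen, dif_neg (by rw [reIndex_deg]; omega)]
theorem repGen_f_re : repGen (.f reIndex) = opF := by
  rw [repGen, dif_neg (by rw [reIndex_deg]; omega)]
theorem repGen_e_im (i : ImIndex) : repGen (.e i.1) = opX 0 i := dif_pos i.2
theorem repGen_f_im (i : ImIndex) : repGen (.f i.1) = opFim i := dif_pos i.2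

theorem repGen_relator (x : FreeL) (hx : Relator x) : FreeLieAlgebra.lift ℂ repGen x = 0 := by
  cases hx with
  | hh i p => simp [repGen, opH_opH]
  | he i p =>
    simp only [map_sub, map_smul, LieHom.map_lie, FreeLieAlgebra.lift_of_apply]
    rw [show repGen (.h i) = opH i from rfl, sub_eq_zero]
    rcases deg_cases p with rfl | hp
    · rw [repGen_e_re, opH_opE]
    · rw [repGen_e_im ⟨p, hp⟩, opH_opX]
      simp
  | hf i p =>
    simp only [map_add, map_smul, LieHom.map_lie, FreeLieAlgebra.lift_of_apply]
    rw [show repGen (.h i) = opH i from rfl, add_eq_zero_iff_eq_neg]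
    rcases deg_cases p with rfl | hp
    · rw [repGen_f_re, opH_opF]
    · rw [repGen_f_im ⟨p, hp⟩, opH_opFim]
  | ef_same i =>
    simp only [map_sub, LieHom.map_lie, FreeLieAlgebra.lift_of_apply]
    rw [show repGen (.h i) = opH i from rfl, sub_eq_zero]
    rcases deg_cases i with rfl | hi
    · rw [repGen_e_re, repGen_f_re, opE_opF]
    · rw [repGen_e_im ⟨i, hi⟩, repGen_f_im ⟨i, hi⟩, opX_opFim_self]
  | ef_ne i p hip =>
    simp only [LieHom.map_lie, FreeLieAlgebra.lift_of_apply]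
    rcases deg_cases i with rfl | hi <;> rcases deg_cases p with rfl | hp
    · exact absurd rfl hip
    · rw [repGen_e_re, repGen_f_im ⟨p, hp⟩, opE_opFim]
    · rw [repGen_e_im ⟨i, hi⟩, repGen_f_re, opX_opF_zero]
    · rw [repGen_e_im ⟨i, hi⟩, repGen_f_im ⟨p, hp⟩, opX_opFim_ne]
      exact fun h => hip (congrArg Subtype.val h)
  | ee i hi =>
    rw [map_ad_pow, FreeLieAlgebra.lift_of_apply, FreeLieAlgebra.lift_of_apply, repGen_e_re,
      repGen_e_im ⟨i, hi⟩, ad_opE_pow, opX_eq_zero]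
    exact Int.self_le_toNat _
  | ff i hi =>
    rw [map_ad_pow, FreeLieAlgebra.lift_of_apply, FreeLieAlgebra.lift_of_apply, repGen_f_re,
      repGen_f_im ⟨i, hi⟩]
    exact opY_deg ⟨i, hi⟩

/-- The representation of `𝔤(A)` on words, induced from the trivial representation of the
parabolic subalgebra. -/
def rep : LieA →ₗ⁅ℂ⁆ Op Letter := lift repGen repGen_relator

theorem rep_e_re : rep (e reIndex) = opE :=
  (FreeLieAlgebra.lift_of_apply ..).trans repGen_e_re

theorem rep_e_im (i : ImIndex) : rep (e i.1) = opX 0 i :=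
  (FreeLieAlgebra.lift_of_apply ..).trans (repGen_e_im i)

/-! ### Nonvanishing of the generators -/

/-- The Lie algebra `𝔤𝔩₂`. -/
def Gl2 : Type := Matrix (Fin 2) (Fin 2) ℂ

instance : LieRing Gl2 := LieRing.ofAssociativeRing (A := Matrix (Fin 2) (Fin 2) ℂ)
instance : LieAlgebra ℂ Gl2 :=
  LieAlgebra.ofAssociativeAlgebra (R := ℂ) (A := Matrix (Fin 2) (Fin 2) ℂ)

/-- Matrices as elements of `𝔤𝔩₂`. -/
def toGl2 (a b c d : ℂ) : Gl2 := !![a, b; c, d]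

theorem toGl2_lie (a b c d a' b' c' d' : ℂ) : ⁅toGl2 a b c d, toGl2 a' b' c' d'⁆ =
    toGl2 (b * c' - b' * c) (a * b' + b * d' - a' * b - b' * d)
      (c * a' + d * c' - c' * a - d' * c) (c * b' - c' * b) := by
  change !![a, b; c, d] * !![a', b'; c', d'] - !![a', b'; c', d'] * !![a, b; c, d] =
    !![_, _; _, _]
  ext i j
  fin_cases i <;> fin_cases j <;> simp <;> ring

theorem toGl2_smul (t a b c d : ℂ) :
    t • toGl2 a b c d = toGl2 (t * a) (t * b) (t * c) (t * d) := by
  change t • !![a, b; c, d] = !![_, _; _, _]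
  ext i j
  fin_cases i <;> fin_cases j <;> simp

theorem toGl2_neg (a b c d : ℂ) : -toGl2 a b c d = toGl2 (-a) (-b) (-c) (-d) := by
  rw [← neg_one_smul ℂ, toGl2_smul]
  simp

theorem toGl2_upper_ne_zero : toGl2 0 1 0 0 ≠ 0 := by
  intro h
  have h' : (!![0, 1; 0, 0] : Matrix (Fin 2) (Fin 2) ℂ) = 0 := h
  simpa using congrFun (congrFun h' 0) 1

open Classical in
/-- The assignment on generators for the homomorphism onto `𝔰𝔩₂` that exists if all imaginary
indices have degree `1`. -/
def slGen : Gen → Gl2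
  | .e i => if i = reIndex then toGl2 0 1 0 0 else 0
  | .f i => if i = reIndex then toGl2 0 0 1 0 else 0
  | .h i => if i = reIndex then toGl2 1 0 0 (-1) else 0

theorem ad_pow_zero_right {L : Type} [LieRing L] [LieAlgebra ℂ L] (n : ℕ) (x : L) :
    ((LieAlgebra.ad ℂ L x) ^ n) 0 = 0 := map_zero _

/-- If all imaginary indices have degree `1`, their Cartan entries with `α_{-1}` vanish, so sending
their generators to `0` is consistent. -/
theorem slGen_relator (hdeg : ∀ i : ImIndex, i.deg ≤ 1) (x : FreeL) (hx : Relator x) :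
    FreeLieAlgebra.lift ℂ slGen x = 0 := by
  have hre : cartan reIndex reIndex = 2 := rfl
  have hc : ∀ i : Index, i ≠ reIndex → cartan i reIndex = 0 := fun i hi => by
    have h1 := (deg_cases i).resolve_left hi
    have h2 : i.deg ≤ 1 := hdeg ⟨i, h1⟩
    change -(i.deg + -1) = 0
    omega
  cases hx with
  | hh i p =>
    simp only [LieHom.map_lie, FreeLieAlgebra.lift_of_apply, slGen]
    split_ifs <;> simp
  | he i p =>
    simp only [map_sub, map_smul, LieHom.map_lie, FreeLieAlgebra.lift_of_apply, slGen]
    by_cases hi : i = reIndex <;> by_cases hp : p = reIndex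
    · simp only [hi, hp, if_true, hre, toGl2_lie, toGl2_smul, sub_eq_zero]
      norm_num
    · simp [hp]
    · simp [hi, hp, hc i hi]
    · simp [hp]
  | hf i p =>
    simp only [map_add, map_smul, LieHom.map_lie, FreeLieAlgebra.lift_of_apply, slGen]
    by_cases hi : i = reIndex <;> by_cases hp : p = reIndex
    · simp only [hi, hp, if_true, hre, toGl2_lie, toGl2_smul, add_eq_zero_iff_eq_neg,
        toGl2_neg]
      norm_num
    · simp [hp]
    · simp [hi, hp, hc i hi]
    · simp [hp]
  | ef_same i =>
    simp only [map_sub, LieHom.map_lie, FreeLieAlgebra.lift_of_apply, slGen]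
    split_ifs
    · rw [toGl2_lie, sub_eq_zero]
      norm_num
    · simp
  | ef_ne i p hip =>
    simp only [LieHom.map_lie, FreeLieAlgebra.lift_of_apply, slGen]
    by_cases hi : i = reIndex
    · rw [if_neg (show p ≠ reIndex from fun h => hip (hi.trans h.symm)), lie_zero]
    · rw [if_neg hi, zero_lie]
  | ee i hi =>
    rw [map_ad_pow, FreeLieAlgebra.lift_of_apply, FreeLieAlgebra.lift_of_apply,
      show slGen (.e i) = 0 from if_neg (ImIndex.ne_reIndex ⟨i, hi⟩), ad_pow_zero_right]
  | ff i hi =>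
    rw [map_ad_pow, FreeLieAlgebra.lift_of_apply, FreeLieAlgebra.lift_of_apply,
      show slGen (.f i) = 0 from if_neg (ImIndex.ne_reIndex ⟨i, hi⟩), ad_pow_zero_right]

theorem consOp_ne_zero {X : Type} (x : X) : consOp x ≠ 0 := by
  intro h
  have h1 := act_consOp_single x []
  rw [h, map_zero, LinearMap.zero_apply] at h1
  exact one_ne_zero (Finsupp.single_eq_zero.1 h1.symm)

theorem opX_ne_zero {l : ℕ} {i : ImIndex} (h : (l : ℤ) < i.deg) : opX l i ≠ 0 := by
  rw [opX, dif_pos h]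
  exact consOp_ne_zero _

/-- The word representation sees `e_{-1}` only if some letter can be raised, that is, if some index
has degree at least `2`. The map to `𝔤𝔩₂` covers the other case, so that no coefficient `c(j)` with
`j ≥ 1` has to be evaluated. -/
theorem e_re_ne_zero : e reIndex ≠ 0 := by
  intro h0
  by_cases hdeg : ∀ i : ImIndex, i.deg ≤ 1
  · have h1 : lift slGen (slGen_relator hdeg) (e reIndex) = slGen (.e reIndex) :=
      FreeLieAlgebra.lift_of_apply ..
    rw [h0, map_zero] at h1
    rw [slGen, if_pos rfl] at h1
    exact toGl2_upper_ne_zero h1.symm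
  · push Not at hdeg
    obtain ⟨i, hi⟩ := hdeg
    refine opX_ne_zero (l := 1) (by exact_mod_cast hi) ?_
    rw [← opE_opX 0 i, ← rep_e_re, h0, map_zero, zero_lie]

theorem e_ne_zero (i : Index) : e i ≠ 0 := by
  rcases deg_cases i with rfl | hi
  · exact e_re_ne_zero
  · intro h0
    have hi' : (1 : ℤ) ≤ ImIndex.deg ⟨i, hi⟩ := hi
    refine opX_ne_zero (l := 0) (i := ⟨i, hi⟩) (by push_cast; omega) ?_
    rw [← rep_e_im, h0, map_zero]

/-! ### Weight spaces -/

theorem lie_incl (t : LieAe) (x : LieA) :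
    ⁅t, incl x⁆ = incl (⁅t.left, x⁆ + (t.right : LieDerivation ℂ LieA LieA) x) := by
  simp

theorem mem_rootSpace {α : Module.Dual ℂ he} {x : LieA} :
    x ∈ rootSpace α ↔
      ∀ t : he, ⁅(t : LieAe).left, x⁆ + ((t : LieAe).right : LieDerivation ℂ LieA LieA) x =
        α t • x := by
  refine forall_congr' fun t => ?_
  rw [lie_incl]
  exact (LieAlgebra.SemiDirectSum.inl_injective d0.incl).eq_iff

/-- The operator on `𝔤(A)` by which an element of `𝔥ᵉ` acts. -/
def tAct (t : he) : LieA →ₗ[ℂ] LieA :=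
  LieAlgebra.ad ℂ LieA (t : LieAe).left +
    ((t : LieAe).right : LieDerivation ℂ LieA LieA).toLinearMap

theorem tAct_apply (t : he) (x : LieA) :
    tAct t x = ⁅(t : LieAe).left, x⁆ + ((t : LieAe).right : LieDerivation ℂ LieA LieA) x := rfl

theorem tAct_lie (t : he) (x y : LieA) : tAct t ⁅x, y⁆ = ⁅tAct t x, y⁆ + ⁅x, tAct t y⁆ := by
  rw [tAct_apply, tAct_apply, tAct_apply, LieDerivation.apply_lie_eq_add, leibniz_lie, add_lie,
    lie_add]
  abel

/-- The root space as a submodule. -/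
def wtSpace (α : Module.Dual ℂ he) : Submodule ℂ LieA := ⨅ t : he, (tAct t - α t • 1).ker

theorem mem_wtSpace {α : Module.Dual ℂ he} {x : LieA} :
    x ∈ wtSpace α ↔ ∀ t : he, tAct t x = α t • x := by
  simp [wtSpace, sub_eq_zero]

theorem mem_rootSpace_iff {α : Module.Dual ℂ he} {x : LieA} :
    x ∈ rootSpace α ↔ x ∈ wtSpace α := by
  rw [mem_rootSpace, mem_wtSpace]
  rfl

theorem lie_mem_wtSpace {α β : Module.Dual ℂ he} {x y : LieA} (hx : x ∈ wtSpace α)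
    (hy : y ∈ wtSpace β) : ⁅x, y⁆ ∈ wtSpace (α + β) := by
  rw [mem_wtSpace] at *
  intro t
  rw [tAct_lie, hx, hy, smul_lie, lie_smul, LinearMap.add_apply, add_smul]

theorem e_mem_wtSpace (i : Index) : e i ∈ wtSpace (simpleRoot i) :=
  mem_rootSpace_iff.1 (simpleRoot_spec i)

theorem exists_tAct_e_f (i : Index) (t : he) :
    ∃ s : ℂ, tAct t (e i) = s • e i ∧ tAct t (f i) = -(s • f i) := by
  simp only [tAct_apply]
  obtain ⟨⟨x, d⟩, hx⟩ := t
  have h1 : ∃ s : ℂ, ⁅x, e i⁆ = s • e i ∧ ⁅x, f i⁆ = -(s • f i) := by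
    have hx' : x ∈ Submodule.span ℂ (Set.range h) := hx
    clear hx
    induction hx' using Submodule.span_induction with
    | zero => exact ⟨0, by simp⟩
    | add a b _ _ ha hb =>
      obtain ⟨r, hr, hr'⟩ := ha
      obtain ⟨s, hs, hs'⟩ := hb
      exact ⟨r + s, by rw [add_lie, hr, hs, add_smul], by
        rw [add_lie, hr', hs', add_smul, neg_add]⟩
    | smul r a _ ha =>
      obtain ⟨s, hs, hs'⟩ := ha
      exact ⟨r * s, by rw [smul_lie, hs, mul_smul], by rw [smul_lie, hs', mul_smul, smul_neg]⟩
    | mem a ha =>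
      obtain ⟨p, rfl⟩ := ha
      exact ⟨_, lie_h_e p i, lie_h_f p i⟩
  have h2 : ∃ s : ℂ, (d : LieDerivation ℂ LieA LieA) (e i) = s • e i ∧
      (d : LieDerivation ℂ LieA LieA) (f i) = -(s • f i) := by
    obtain ⟨d, hd⟩ := d
    have hd' : d ∈ Submodule.span ℂ extraDer := hd
    change ∃ s : ℂ, d (e i) = s • e i ∧ d (f i) = -(s • f i)
    clear hd hx h1
    induction hd' using Submodule.span_induction with
    | zero => exact ⟨0, by simp⟩
    | add a b _ _ ha hb =>
      obtain ⟨r, hr, hr'⟩ := ha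
      obtain ⟨s, hs, hs'⟩ := hb
      exact ⟨r + s, by rw [LieDerivation.add_apply, hr, hs, add_smul], by
        rw [LieDerivation.add_apply, hr', hs', add_smul, neg_add]⟩
    | smul r a _ ha =>
      obtain ⟨s, hs, hs'⟩ := ha
      exact ⟨r * s, by rw [LieDerivation.smul_apply, hs, mul_smul], by
        rw [LieDerivation.smul_apply, hs', mul_smul, smul_neg]⟩
    | mem a ha =>
      obtain ⟨p, -, -, rfl⟩ := ha
      exact ⟨_, weightDer_e _ i, by rw [D, weightDer_f, neg_smul]⟩
  obtain ⟨r, hr, hr'⟩ := h1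
  obtain ⟨s, hs, hs'⟩ := h2
  refine ⟨r + s, ?_, ?_⟩
  · change ⁅x, e i⁆ + (d : LieDerivation ℂ LieA LieA) (e i) = _
    rw [hr, hs, add_smul]
  · change ⁅x, f i⁆ + (d : LieDerivation ℂ LieA LieA) (f i) = _
    rw [hr', hs', add_smul, neg_add]

/-- `simpleRoot` is a chosen functional; `e i ≠ 0` makes it computable from eigenvalues. -/
theorem simpleRoot_eq {i : Index} {t : he} {s : ℂ} (hs : tAct t (e i) = s • e i) :
    simpleRoot i t = s :=
  smul_left_injective ℂ (e_ne_zero i) ((mem_wtSpace.1 (e_mem_wtSpace i) t).symm.trans hs)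

theorem f_mem_wtSpace (i : Index) : f i ∈ wtSpace (-simpleRoot i) := by
  rw [mem_wtSpace]
  intro t
  obtain ⟨s, hs, hs'⟩ := exists_tAct_e_f i t
  rw [hs', LinearMap.neg_apply, simpleRoot_eq hs, neg_smul]

theorem h_mem_wtSpace (i : Index) : h i ∈ wtSpace 0 := by
  rw [← lie_e_f_same, ← add_neg_cancel (simpleRoot i)]
  exact lie_mem_wtSpace (e_mem_wtSpace i) (f_mem_wtSpace i)

/-! ### Linear independence of the simple roots -/

/-- The element `h_p` of `𝔥ᵉ`. -/
def heH (p : Index) : he := ⟨⟨h p, 0⟩, Submodule.subset_span ⟨p, rfl⟩⟩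

/-- The element `D_p` of `𝔥ᵉ`. -/
def heD (p : Index) (h1 : p.1 ≠ (-1, 1)) (h2 : p.1 ≠ (1, 1)) : he :=
  ⟨⟨0, ⟨D p, Submodule.subset_span ⟨p, h1, h2, rfl⟩⟩⟩, hA.zero_mem⟩

theorem simpleRoot_heH (p i : Index) : simpleRoot i (heH p) = cartan p i := by
  refine simpleRoot_eq ?_
  change ⁅h p, e i⁆ + (0 : LieDerivation ℂ LieA LieA) (e i) = _
  rw [lie_h_e, LieDerivation.zero_apply, add_zero]

theorem simpleRoot_heD (p : Index) (h1 : p.1 ≠ (-1, 1)) (h2 : p.1 ≠ (1, 1)) (i : Index) :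
    simpleRoot i (heD p h1 h2) = (Pi.single p 1 : Index → ℂ) i := by
  refine simpleRoot_eq ?_
  change ⁅(0 : LieA), e i⁆ + D p (e i) = _
  rw [zero_lie, zero_add, D, weightDer_e]

theorem latticeElt_apply (a : Index →₀ ℤ) (t : he) :
    latticeElt a t = a.sum fun i n => (n : ℂ) * simpleRoot i t := by
  simp [latticeElt, Finsupp.sum, LinearMap.sum_apply]

/-- The map from the root lattice to the dual of the Cartan subalgebra, as a homomorphism. -/
def latticeHom : (Index →₀ ℤ) →+ Module.Dual ℂ he :=
  Finsupp.liftAddHom fun i => AddMonoidHom.flip (AddMonoidHom.mk' (fun n : ℤ => AddMonoidHom.mk'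
    (fun x : Module.Dual ℂ he => n • x) fun x y => smul_add n x y)
      fun m n => by ext x : 1; exact add_smul m n x) (simpleRoot i)

theorem latticeHom_apply (a : Index →₀ ℤ) : latticeHom a = latticeElt a := rfl

theorem latticeElt_zero : latticeElt 0 = 0 := map_zero latticeHom

theorem latticeElt_add (a b : Index →₀ ℤ) :
    latticeElt (a + b) = latticeElt a + latticeElt b := map_add latticeHom a b

theorem latticeElt_neg (a : Index →₀ ℤ) : latticeElt (-a) = -latticeElt a := map_neg latticeHom a

theorem latticeElt_single (i : Index) (n : ℤ) :
    latticeElt (Finsupp.single i n) = n • simpleRoot i := by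
  simp [latticeElt]

/-- `D_p` reads off the coefficient at `p`, except for the indices `(-1, 1)` and `(1, 1)`. These two
are orthogonal with norms `2` and `-2`, so `h_p` reads off what remains. -/
theorem latticeElt_injective : Function.Injective latticeElt := by
  refine (injective_iff_map_eq_zero latticeHom).2 fun a ha => ?_
  have hev : ∀ t : he, (a.sum fun i n => (n : ℂ) * simpleRoot i t) = 0 := fun t => by
    rw [← latticeElt_apply, ← latticeHom_apply, ha, LinearMap.zero_apply]
  have hD : ∀ p : Index, p ≠ reIndex → p.1 ≠ (1, 1) → a p = 0 := fun p hp hp' => by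
    classical
    have h1 := hev (heD p (fun h => hp (Subtype.ext h)) hp')
    simp only [simpleRoot_heD, Pi.single_apply, mul_ite, mul_one, mul_zero] at h1
    rw [Finsupp.sum, Finset.sum_ite_eq'] at h1
    by_contra hne
    rw [if_pos (Finsupp.mem_support_iff.2 hne)] at h1
    exact hne (by exact_mod_cast h1)
  have hre : a reIndex = 0 := by
    have h1 := hev (heH reIndex)
    simp only [simpleRoot_heH] at h1
    rw [Finsupp.sum, Finset.sum_eq_single reIndex] at h1
    · rw [show cartan reIndex reIndex = 2 from rfl] at h1
      simpa using h1
    · intro i _ hi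
      by_cases hi' : i.1 = (1, 1)
      · have : cartan reIndex i = 0 := by
          change -(-1 + i.1.1) = 0
          rw [hi']
          norm_num
        rw [this, Int.cast_zero, mul_zero]
      · rw [hD i hi hi', Int.cast_zero, zero_mul]
    · intro h2
      rw [Finsupp.notMem_support_iff.1 h2, Int.cast_zero, zero_mul]
  ext q
  by_cases hq : q.1 = (1, 1)
  · have h1 := hev (heH q)
    simp only [simpleRoot_heH] at h1
    rw [Finsupp.sum, Finset.sum_eq_single q] at h1
    · have : cartan q q = -2 := by
        change -(q.1.1 + q.1.1) = -2
        rw [hq]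
        norm_num
      rw [this] at h1
      simpa using h1
    · intro i _ hi
      by_cases hi' : i = reIndex
      · rw [hi', hre, Int.cast_zero, zero_mul]
      · rw [hD i hi' fun h => hi (Subtype.ext (h.trans hq.symm)), Int.cast_zero, zero_mul]
    · intro h2
      rw [Finsupp.notMem_support_iff.1 h2, Int.cast_zero, zero_mul]
  · by_cases hq' : q = reIndex
    · rw [hq', hre]
      rfl
    · exact hD q hq' hq

/-! ### Independence of weight spaces -/

theorem wtSpace_sum_eq_zero (F : Finset (Module.Dual ℂ he)) (x : Module.Dual ℂ he → LieA)
    (hx : ∀ α ∈ F, x α ∈ wtSpace α) (h0 : ∑ α ∈ F, x α = 0) : ∀ α ∈ F, x α = 0 := by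
  classical
  induction F using Finset.induction_on generalizing x with
  | empty => simp
  | insert β F hβ ih =>
    have h1 : ∀ α ∈ F, x α = 0 := by
      intro α hα
      obtain ⟨t, ht⟩ : ∃ t, α t ≠ β t := by
        by_contra! hcon
        exact hβ ((LinearMap.ext hcon : α = β) ▸ hα)
      -- Apply `tAct t - β t` to the relation: the `β`-term disappears, and the coefficient at `α`
      -- is nonzero by the choice of `t`.
      have h2 := ih (fun γ => (γ t - β t) • x γ)
        (fun γ hγ => (wtSpace γ).smul_mem _ (hx γ (Finset.mem_insert_of_mem hγ))) (by
          have h3 := congrArg (fun y => tAct t y - β t • y) h0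
          simp only [map_sum, map_zero, smul_zero, sub_zero, Finset.smul_sum,
            ← Finset.sum_sub_distrib] at h3
          rw [Finset.sum_insert hβ, mem_wtSpace.1 (hx β (Finset.mem_insert_self _ _)) t, sub_self,
            zero_add] at h3
          rw [← h3]
          refine Finset.sum_congr rfl fun γ hγ => ?_
          rw [mem_wtSpace.1 (hx γ (Finset.mem_insert_of_mem hγ)) t, sub_smul]) α hα
      exact (smul_eq_zero.1 h2).resolve_left (sub_ne_zero.2 ht)
    intro α hα
    rcases Finset.mem_insert.1 hα with rfl | hα
    · rwa [Finset.sum_insert hβ, Finset.sum_eq_zero h1, add_zero] at h0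
    · exact h1 α hα

theorem mem_of_mem_iSup_wtSpace {P : Set (Module.Dual ℂ he)} {α : Module.Dual ℂ he} {x : LieA}
    (hx : x ∈ wtSpace α) (hx0 : x ≠ 0) (hP : x ∈ ⨆ β ∈ P, wtSpace β) : α ∈ P := by
  classical
  rw [iSup_subtype', Submodule.mem_iSup_iff_exists_finsupp] at hP
  obtain ⟨u, hu, hsum⟩ := hP
  by_contra hα
  -- If `α ∉ P`, placing `-x` at `α` next to the components of `x` gives a relation between vectors
  -- of distinct weights.
  let y : Module.Dual ℂ he → LieA := fun β =>
    if h : β ∈ P then u ⟨β, h⟩ else -x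
  have hy : ∀ β : P, y β = u β := fun β => dif_pos β.2
  have hyα : y α = -x := dif_neg hα
  let F := u.support.map (Function.Embedding.subtype (· ∈ P))
  have hαF : α ∉ F := by
    simp only [F, Finset.mem_map, not_exists, not_and]
    rintro β - rfl
    exact hα β.2
  refine hx0 (neg_eq_zero.1 (hyα ▸ wtSpace_sum_eq_zero (insert α F) y ?_ ?_ α
    (Finset.mem_insert_self _ _)))
  · intro β hβ
    rcases Finset.mem_insert.1 hβ with rfl | hβ
    · rw [hyα]
      exact (wtSpace _).neg_mem hx
    · obtain ⟨γ, -, rfl⟩ := Finset.mem_map.1 hβ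
      change y γ ∈ _
      rw [hy]
      exact hu γ
  · rw [Finset.sum_insert hαF, hyα, Finset.sum_map, neg_add_eq_zero, ← hsum, Finsupp.sum]
    exact Finset.sum_congr rfl fun β _ => (hy β).symm

/-! ### The Chevalley involution -/

/-- The Chevalley involution on generators. -/
def chevGen : Gen → LieA
  | .e i => f i
  | .f i => e i
  | .h i => -h i

theorem chevGen_relator (x : FreeL) (hx : Relator x) : FreeLieAlgebra.lift ℂ chevGen x = 0 := by
  cases hx with
  | hh i p => simp [chevGen, lie_h_h]
  | he i p => simp [chevGen, lie_h_f]
  | hf i p => simp [chevGen, lie_h_e]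
  | ef_same i =>
    simp only [map_sub, LieHom.map_lie, FreeLieAlgebra.lift_of_apply, chevGen]
    rw [← lie_skew, lie_e_f_same, sub_self]
  | ef_ne i p hip =>
    simp only [LieHom.map_lie, FreeLieAlgebra.lift_of_apply, chevGen]
    rw [← lie_skew, lie_e_f_ne (Ne.symm hip), neg_zero]
  | ee i hi =>
    rw [map_ad_pow, FreeLieAlgebra.lift_of_apply, FreeLieAlgebra.lift_of_apply]
    exact ad_pow_f i hi
  | ff i hi =>
    rw [map_ad_pow, FreeLieAlgebra.lift_of_apply, FreeLieAlgebra.lift_of_apply]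
    exact ad_pow_e i hi

/-- The Chevalley involution, with `e_i ↦ f_i`, `f_i ↦ e_i` and `h_i ↦ -h_i`. -/
def chev : LieA →ₗ⁅ℂ⁆ LieA := lift chevGen chevGen_relator

theorem chev_e (i : Index) : chev (e i) = f i := FreeLieAlgebra.lift_of_apply ..
theorem chev_f (i : Index) : chev (f i) = e i := FreeLieAlgebra.lift_of_apply ..
theorem chev_h (i : Index) : chev (h i) = -h i := FreeLieAlgebra.lift_of_apply ..

theorem chev_chev (x : LieA) : chev (chev x) = x := by
  have : chev.comp chev = LieHom.id := hom_ext
    (fun i => by simp only [LieHom.comp_apply, chev_e, chev_f, LieHom.id_apply])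
    (fun i => by simp only [LieHom.comp_apply, chev_e, chev_f, LieHom.id_apply])
    (fun i => by simp only [LieHom.comp_apply, chev_h, map_neg, neg_neg, LieHom.id_apply])
  exact LieHom.congr_fun this x

theorem lieA_induction {p : LieA → Prop} (he : ∀ i, p (e i)) (hf : ∀ i, p (f i))
    (hh : ∀ i, p (h i)) (hzero : p 0) (hadd : ∀ x y, p x → p y → p (x + y))
    (hsmul : ∀ (r : ℂ) x, p x → p (r • x)) (hlie : ∀ x y, p x → p y → p ⁅x, y⁆) (x : LieA) :
    p x := by
  let K : LieSubalgebra ℂ LieA :=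
    { carrier := {x | p x}
      zero_mem' := hzero
      add_mem' := fun {x y} => hadd x y
      smul_mem' := hsmul
      lie_mem' := fun {x y} => hlie x y }
  have hK : LieSubalgebra.lieSpan ℂ LieA (Set.range e ∪ Set.range f ∪ Set.range h) ≤ K :=
    LieSubalgebra.lieSpan_le.2 (by
      rintro _ ((⟨i, rfl⟩ | ⟨i, rfl⟩) | ⟨i, rfl⟩)
      exacts [he i, hf i, hh i])
  rw [lieSpan_generators] at hK
  exact hK (LieSubalgebra.mem_top x)

/-- It suffices to check generators, where `e_i` and `f_i` have opposite eigenvalues. The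
consequence is `Δ = -Δ`. -/
theorem tAct_chev (t : he) (x : LieA) : tAct t (chev x) = -chev (tAct t x) := by
  induction x using lieA_induction with
  | he i =>
    obtain ⟨s, hs, hs'⟩ := exists_tAct_e_f i t
    rw [chev_e, hs, hs', map_smul, chev_e]
  | hf i =>
    obtain ⟨s, hs, hs'⟩ := exists_tAct_e_f i t
    rw [chev_f, hs, hs', map_neg, map_smul, chev_f, neg_neg]
  | hh i =>
    have := mem_wtSpace.1 (h_mem_wtSpace i) t
    rw [LinearMap.zero_apply, zero_smul] at this
    rw [chev_h, map_neg, this, map_zero]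
  | hzero => simp
  | hadd x y hx hy => rw [map_add, map_add, hx, hy, map_add, map_add, neg_add]
  | hsmul r x hx => rw [map_smul, map_smul, hx, map_smul, map_smul, smul_neg]
  | hlie x y hx hy =>
    rw [LieHom.map_lie, tAct_lie, hx, hy, tAct_lie, map_add, LieHom.map_lie, LieHom.map_lie,
      neg_lie, lie_neg, neg_add]

theorem chev_mem_wtSpace {α : Module.Dual ℂ he} {x : LieA} (hx : x ∈ wtSpace α) :
    chev x ∈ wtSpace (-α) := by
  rw [mem_wtSpace] at *
  intro t
  rw [tAct_chev, hx, map_smul, LinearMap.neg_apply, neg_smul]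

theorem chev_ne_zero {x : LieA} (hx : x ≠ 0) : chev x ≠ 0 := fun h0 => hx (by
  rw [← chev_chev x, h0, map_zero])

/-! ### The triangular decomposition -/

/-- The vectors `(ad e_{-1})^ℓ e_{jk}`. -/
def xvec (l : ℕ) (i : ImIndex) : LieA := ((LieAlgebra.ad ℂ LieA (e reIndex)) ^ l) (e i.1)

theorem xvec_zero (i : ImIndex) : xvec 0 i = e i.1 := rfl

theorem xvec_succ (l : ℕ) (i : ImIndex) : xvec (l + 1) i = ⁅e reIndex, xvec l i⁆ := by
  rw [xvec, pow_succ', Module.End.mul_apply, LieAlgebra.ad_apply, xvec]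

theorem xvec_eq_zero {l : ℕ} {i : ImIndex} (h : i.deg ≤ l) : xvec l i = 0 := by
  obtain ⟨k, rfl⟩ : ∃ k, l = k + i.deg.toNat := ⟨l - i.deg.toNat, by omega⟩
  rw [xvec, pow_add, Module.End.mul_apply, ad_pow_e i.1 i.2, map_zero]

theorem lie_f_im_e_re (i : ImIndex) : ⁅f i.1, e reIndex⁆ = 0 := by
  rw [← lie_skew, lie_e_f_ne i.ne_reIndex.symm, neg_zero]

theorem lie_f_re_e_im (i : ImIndex) : ⁅f reIndex, e i.1⁆ = 0 := by
  rw [← lie_skew, lie_e_f_ne i.ne_reIndex, neg_zero]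

theorem exists_lie_h_xvec (p : Index) (l : ℕ) (i : ImIndex) :
    ∃ s : ℂ, ⁅h p, xvec l i⁆ = s • xvec l i := by
  induction l with
  | zero => exact ⟨_, lie_h_e p i.1⟩
  | succ l ih =>
    obtain ⟨s, hs⟩ := ih
    exact ⟨cartan p reIndex + s, by
      rw [xvec_succ, leibniz_lie, hs, lie_h_e, smul_lie, lie_smul, add_smul]⟩

/-- The value of the scalar is irrelevant for spanning arguments. At `l = 0` the bracket is zero, so
the truncated `l - 1` does no harm. -/
theorem exists_lie_f_re_xvec (l : ℕ) (i : ImIndex) :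
    ∃ s : ℂ, ⁅f reIndex, xvec l i⁆ = s • xvec (l - 1) i := by
  induction l with
  | zero => exact ⟨0, by rw [xvec_zero, lie_f_re_e_im, zero_smul]⟩
  | succ l ih =>
    obtain ⟨s, hs⟩ := ih
    obtain ⟨r, hr⟩ := exists_lie_h_xvec reIndex l i
    rcases l with _ | l
    · exact ⟨-r, by
        rw [xvec_succ, leibniz_lie, ← lie_skew (f reIndex) (e reIndex), lie_e_f_same, neg_lie, hr,
          xvec_zero, lie_f_re_e_im, lie_zero, add_zero, neg_smul]⟩
    · exact ⟨-r + s, by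
        rw [xvec_succ, leibniz_lie, ← lie_skew (f reIndex) (e reIndex), lie_e_f_same, neg_lie, hr,
          hs, lie_smul, Nat.add_sub_cancel, Nat.add_sub_cancel, ← xvec_succ, add_smul, neg_smul]⟩

/-- The subalgebra generated by the vectors `(ad e_{-1})^ℓ e_{jk}`. -/
def nPlus : LieSubalgebra ℂ LieA :=
  LieSubalgebra.lieSpan ℂ LieA (Set.range fun x : Letter => xvec x.1.2 x.1.1)

theorem xvec_mem_nPlus (l : ℕ) (i : ImIndex) : xvec l i ∈ nPlus := by
  by_cases hl : (l : ℤ) < i.deg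
  · exact LieSubalgebra.subset_lieSpan ⟨⟨(i, l), hl⟩, rfl⟩
  · rw [xvec_eq_zero (not_lt.1 hl)]
    exact nPlus.zero_mem

/-- A derivation preserves a subalgebra as soon as it maps the generators into it. -/
theorem lie_mem_nPlus_of_xvec {d : LieA} (hd : ∀ l i, ⁅d, xvec l i⁆ ∈ nPlus) {x : LieA}
    (hx : x ∈ nPlus) : ⁅d, x⁆ ∈ nPlus := by
  induction hx using LieSubalgebra.lieSpan_induction with
  | mem x h =>
    obtain ⟨x, rfl⟩ := h
    exact hd _ _
  | zero => rw [lie_zero]; exact nPlus.zero_mem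
  | add x y _ _ h1 h2 => rw [lie_add]; exact nPlus.add_mem h1 h2
  | smul r x _ h1 => rw [lie_smul]; exact nPlus.smul_mem r h1
  | lie x y hx hy h1 h2 =>
    rw [leibniz_lie]
    exact nPlus.add_mem (nPlus.lie_mem h1 hy) (nPlus.lie_mem hx h2)

theorem lie_e_re_mem_nPlus {x : LieA} (hx : x ∈ nPlus) : ⁅e reIndex, x⁆ ∈ nPlus :=
  lie_mem_nPlus_of_xvec (fun l i => by rw [← xvec_succ]; exact xvec_mem_nPlus _ _) hx

theorem lie_f_re_mem_nPlus {x : LieA} (hx : x ∈ nPlus) : ⁅f reIndex, x⁆ ∈ nPlus :=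
  lie_mem_nPlus_of_xvec (fun l i => by
    obtain ⟨s, hs⟩ := exists_lie_f_re_xvec l i
    rw [hs]
    exact nPlus.smul_mem _ (xvec_mem_nPlus _ _)) hx

theorem lie_h_mem_nPlus (p : Index) {x : LieA} (hx : x ∈ nPlus) : ⁅h p, x⁆ ∈ nPlus :=
  lie_mem_nPlus_of_xvec (fun l i => by
    obtain ⟨s, hs⟩ := exists_lie_h_xvec p l i
    rw [hs]
    exact nPlus.smul_mem _ (xvec_mem_nPlus _ _)) hx

/-- The span of `e_{-1}`, `f_{-1}` and the `h_{jk}`. -/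
def gZero : Submodule ℂ LieA := Submodule.span ℂ ({e reIndex, f reIndex} ∪ Set.range h)

theorem e_re_mem_gZero : e reIndex ∈ gZero := Submodule.subset_span (by simp)
theorem f_re_mem_gZero : f reIndex ∈ gZero := Submodule.subset_span (by simp)
theorem h_mem_gZero (p : Index) : h p ∈ gZero := Submodule.subset_span (by simp)

theorem lie_gZero_mem_nPlus {d x : LieA} (hd : d ∈ gZero) (hx : x ∈ nPlus) : ⁅d, x⁆ ∈ nPlus := by
  induction hd using Submodule.span_induction with
  | mem x h =>
    rcases h with (rfl | rfl) | ⟨p, rfl⟩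
    · exact lie_e_re_mem_nPlus hx
    · exact lie_f_re_mem_nPlus hx
    · exact lie_h_mem_nPlus p hx
  | zero => rw [zero_lie]; exact nPlus.zero_mem
  | add a b _ _ ha hb => rw [add_lie]; exact nPlus.add_mem ha hb
  | smul r a _ ha => rw [smul_lie]; exact nPlus.smul_mem r ha

theorem lie_e_re_mem_gZero {x : LieA} (hx : x ∈ gZero) : ⁅e reIndex, x⁆ ∈ gZero := by
  induction hx using Submodule.span_induction with
  | mem x h =>
    rcases h with (rfl | rfl) | ⟨p, rfl⟩
    · rw [lie_self]
      exact gZero.zero_mem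
    · rw [lie_e_f_same]
      exact h_mem_gZero _
    · rw [← lie_skew, lie_h_e]
      exact gZero.neg_mem (gZero.smul_mem _ e_re_mem_gZero)
  | zero => rw [lie_zero]; exact gZero.zero_mem
  | add a b _ _ ha hb => rw [lie_add]; exact gZero.add_mem ha hb
  | smul r a _ ha => rw [lie_smul]; exact gZero.smul_mem r ha

theorem lie_e_im_gZero (i : ImIndex) {x : LieA} (hx : x ∈ gZero) : ⁅e i.1, x⁆ ∈ nPlus := by
  rw [← lie_skew]
  exact nPlus.neg_mem (lie_gZero_mem_nPlus hx (xvec_mem_nPlus 0 i))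

theorem chev_mem_gZero {x : LieA} (hx : x ∈ gZero) : chev x ∈ gZero := by
  induction hx using Submodule.span_induction with
  | mem x h =>
    rcases h with (rfl | rfl) | ⟨p, rfl⟩
    · rw [chev_e]
      exact f_re_mem_gZero
    · rw [chev_f]
      exact e_re_mem_gZero
    · rw [chev_h]
      exact gZero.neg_mem (h_mem_gZero p)
  | zero => rw [map_zero]; exact gZero.zero_mem
  | add a b _ _ ha hb => rw [map_add]; exact gZero.add_mem ha hb
  | smul r a _ ha => rw [map_smul]; exact gZero.smul_mem r ha

theorem lie_f_im_xvec (p : ImIndex) (l : ℕ) (i : ImIndex) : ⁅f p.1, xvec l i⁆ ∈ gZero := by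
  induction l with
  | zero =>
    rw [xvec_zero, ← lie_skew]
    by_cases hip : i = p
    · rw [hip, lie_e_f_same]
      exact gZero.neg_mem (h_mem_gZero _)
    · rw [lie_e_f_ne fun h => hip (Subtype.ext h)]
      exact gZero.neg_mem gZero.zero_mem
  | succ l ih =>
    rw [xvec_succ, leibniz_lie, lie_f_im_e_re, zero_lie, zero_add]
    exact lie_e_re_mem_gZero ih

/-- `f_p` removes one imaginary simple root: it sends letters into `gZero`, and brackets stay in
`nPlus` because `gZero` and `nPlus` both normalise `nPlus`. -/
theorem lie_f_im_nPlus (p : ImIndex) {x : LieA} (hx : x ∈ nPlus) :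
    ⁅f p.1, x⁆ ∈ gZero ⊔ nPlus.toSubmodule := by
  have key : ∀ u v : LieA, u ∈ gZero ⊔ nPlus.toSubmodule → v ∈ nPlus → ⁅u, v⁆ ∈ nPlus := by
    intro u v hu hv
    obtain ⟨a, ha, b, hb, rfl⟩ := Submodule.mem_sup.1 hu
    rw [add_lie]
    exact nPlus.add_mem (lie_gZero_mem_nPlus ha hv) (nPlus.lie_mem hb hv)
  induction hx using LieSubalgebra.lieSpan_induction with
  | mem x h =>
    obtain ⟨x, rfl⟩ := h
    exact Submodule.mem_sup_left (lie_f_im_xvec p _ _)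
  | zero => rw [lie_zero]; exact Submodule.zero_mem _
  | add x y _ _ h1 h2 => rw [lie_add]; exact Submodule.add_mem _ h1 h2
  | smul r x _ h1 => rw [lie_smul]; exact Submodule.smul_mem _ r h1
  | lie x y hx hy h1 h2 =>
    rw [leibniz_lie]
    refine Submodule.mem_sup_right (nPlus.add_mem (key _ _ h1 hy) ?_)
    rw [← lie_skew]
    exact nPlus.neg_mem (key _ _ h2 hx)

/-- The sum on the right contains the generators, is stable under the Chevalley involution and under
every `ad e_i`, hence under `ad f_i` by conjugation and under `ad h_i = [ad e_i, ad f_i]`.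
Directness is not needed. -/
theorem exists_triangular (x : LieA) :
    ∃ u ∈ nPlus, ∃ a ∈ gZero, ∃ v ∈ nPlus, x = u + a + chev v := by
  let A : Submodule ℂ LieA :=
    { carrier := {x | ∃ u ∈ nPlus, ∃ a ∈ gZero, ∃ v ∈ nPlus, x = u + a + chev v}
      zero_mem' := ⟨0, nPlus.zero_mem, 0, gZero.zero_mem, 0, nPlus.zero_mem, by simp⟩
      add_mem' := by
        rintro _ _ ⟨u, hu, a, ha, v, hv, rfl⟩ ⟨u', hu', a', ha', v', hv', rfl⟩
        refine ⟨u + u', nPlus.add_mem hu hu', a + a', gZero.add_mem ha ha', v + v',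
          nPlus.add_mem hv hv', ?_⟩
        rw [map_add]
        abel
      smul_mem' := by
        rintro r _ ⟨u, hu, a, ha, v, hv, rfl⟩
        refine ⟨r • u, nPlus.smul_mem r hu, r • a, gZero.smul_mem r ha, r • v,
          nPlus.smul_mem r hv, ?_⟩
        rw [map_smul, smul_add, smul_add] }
  have hn : ∀ u ∈ nPlus, u ∈ A := fun u hu =>
    ⟨u, hu, 0, gZero.zero_mem, 0, nPlus.zero_mem, by simp⟩
  have hg : ∀ a ∈ gZero, a ∈ A := fun a ha =>
    ⟨0, nPlus.zero_mem, a, ha, 0, nPlus.zero_mem, by simp⟩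
  have hm : ∀ v ∈ nPlus, chev v ∈ A := fun v hv =>
    ⟨0, nPlus.zero_mem, 0, gZero.zero_mem, v, hv, by simp⟩
  have hchev : ∀ x ∈ A, chev x ∈ A := by
    rintro _ ⟨u, hu, a, ha, v, hv, rfl⟩
    rw [map_add, map_add, chev_chev]
    exact A.add_mem (A.add_mem (hm u hu) (hg _ (chev_mem_gZero ha))) (hn v hv)
  have hgn : ∀ y ∈ gZero ⊔ nPlus.toSubmodule, y ∈ A := by
    intro y hy
    obtain ⟨a, ha, b, hb, rfl⟩ := Submodule.mem_sup.1 hy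
    exact A.add_mem (hg a ha) (hn b hb)
  have hlie_e : ∀ i, ∀ x ∈ A, ⁅e i, x⁆ ∈ A := by
    rintro i _ ⟨u, hu, a, ha, v, hv, rfl⟩
    have hf : ⁅e i, chev v⁆ = chev ⁅f i, v⁆ := by rw [LieHom.map_lie, chev_f]
    rw [lie_add, lie_add, hf]
    rcases deg_cases i with rfl | hi
    · exact A.add_mem (A.add_mem (hn _ (lie_e_re_mem_nPlus hu)) (hg _ (lie_e_re_mem_gZero ha)))
        (hm _ (lie_f_re_mem_nPlus hv))
    · exact A.add_mem (A.add_mem (hn _ (nPlus.lie_mem (xvec_mem_nPlus 0 ⟨i, hi⟩) hu))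
        (hn _ (lie_e_im_gZero ⟨i, hi⟩ ha))) (hchev _ (hgn _ (lie_f_im_nPlus ⟨i, hi⟩ hv)))
  have hlie_f : ∀ i, ∀ x ∈ A, ⁅f i, x⁆ ∈ A := by
    intro i x hx
    have h1 := hchev _ (hlie_e i _ (hchev x hx))
    rwa [LieHom.map_lie, chev_e, chev_chev] at h1
  have he : ∀ i, e i ∈ A := fun i => by
    rcases deg_cases i with rfl | hi
    · exact hg _ e_re_mem_gZero
    · exact hn _ (xvec_mem_nPlus 0 ⟨i, hi⟩)
  have hall : ∀ y : LieA, ∀ x ∈ A, ⁅y, x⁆ ∈ A := by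
    intro y
    induction y using lieA_induction with
    | he i => exact hlie_e i
    | hf i => exact hlie_f i
    | hh i =>
      intro x hx
      rw [← lie_e_f_same, lie_lie]
      exact A.sub_mem (hlie_e i _ (hlie_f i _ hx)) (hlie_f i _ (hlie_e i _ hx))
    | hzero => intro x _; rw [zero_lie]; exact A.zero_mem
    | hadd y y' h1 h2 => intro x hx; rw [add_lie]; exact A.add_mem (h1 x hx) (h2 x hx)
    | hsmul r y h1 => intro x hx; rw [smul_lie]; exact A.smul_mem r (h1 x hx)
    | hlie y y' h1 h2 =>
      intro x hx
      rw [lie_lie]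
      exact A.sub_mem (h1 _ (h2 x hx)) (h2 _ (h1 x hx))
  change x ∈ A
  induction x using lieA_induction with
  | he i => exact he i
  | hf i => rw [← chev_e]; exact hchev _ (he i)
  | hh i => exact hg _ (h_mem_gZero i)
  | hzero => exact A.zero_mem
  | hadd x y h1 h2 => exact A.add_mem h1 h2
  | hsmul r x h1 => exact A.smul_mem r h1
  | hlie x y _ h2 => exact hall x y h2

/-! ### Weights of the subalgebra `nPlus` -/

/-- The weight `ℓ α_{-1} + α_{jk}` of a letter. -/
def Letter.wt (x : Letter) : Index →₀ ℤ :=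
  Finsupp.single reIndex (x.1.2 : ℤ) + Finsupp.single x.1.1.1 1

/-- The weight of a multiset of letters. -/
def mwt (s : Multiset Letter) : Index →₀ ℤ := (s.map Letter.wt).sum

theorem mwt_add (s t : Multiset Letter) : mwt (s + t) = mwt s + mwt t := by
  simp [mwt]

theorem mwt_singleton (x : Letter) : mwt {x} = x.wt := by simp [mwt]

/-- A multiset of letters is mixed if it has two different members. -/
def Mixed (s : Multiset Letter) : Prop := ∃ x ∈ s, ∃ y ∈ s, x ≠ y

/-- The weights of the free Lie algebra on the letters. -/
def freeWeights : Set (Index →₀ ℤ) := {μ | ∃ s, ((∃ x, s = {x}) ∨ Mixed s) ∧ μ = mwt s}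

theorem xvec_mem_wtSpace (l : ℕ) (i : ImIndex) :
    xvec l i ∈ wtSpace (latticeElt (Finsupp.single reIndex (l : ℤ) + Finsupp.single i.1 1)) := by
  induction l with
  | zero =>
    rw [Nat.cast_zero, Finsupp.single_zero, zero_add, latticeElt_single, one_smul]
    exact e_mem_wtSpace _
  | succ l ih =>
    have h1 := lie_mem_wtSpace (e_mem_wtSpace reIndex) ih
    rw [xvec_succ]
    convert h1 using 2
    simp only [latticeElt_add, latticeElt_single, Nat.cast_succ, add_smul, one_smul]
    abel

theorem letter_mem_wtSpace (x : Letter) : xvec x.1.2 x.1.1 ∈ wtSpace (latticeElt x.wt) :=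
  xvec_mem_wtSpace _ _

/-- The span of the letters and of the weight vectors of mixed weight. -/
def letterSpan : Submodule ℂ LieA :=
  Submodule.span ℂ ((Set.range fun x : Letter => xvec x.1.2 x.1.1) ∪
    {u | ∃ s, Mixed s ∧ u ∈ wtSpace (latticeElt (mwt s))})

theorem Mixed.add_right {s : Multiset Letter} (hs : Mixed s) (t : Multiset Letter) :
    Mixed (s + t) := by
  obtain ⟨x, hx, y, hy, h⟩ := hs
  exact ⟨x, Multiset.mem_add.2 (Or.inl hx), y, Multiset.mem_add.2 (Or.inl hy), h⟩

/-- The only bracket of spanning vectors whose multiset could fail to be mixed is that of a letter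
with itself, and it is zero. -/
theorem lie_mem_letterSpan {u v : LieA} (hu : u ∈ letterSpan) (hv : v ∈ letterSpan) :
    ⁅u, v⁆ ∈ letterSpan := by
  have hmix : ∀ s t : Multiset Letter, Mixed (s + t) → ∀ u v : LieA,
      u ∈ wtSpace (latticeElt (mwt s)) → v ∈ wtSpace (latticeElt (mwt t)) →
      ⁅u, v⁆ ∈ letterSpan := by
    intro s t hst u v hu hv
    refine Submodule.subset_span (Or.inr ⟨s + t, hst, ?_⟩)
    rw [mwt_add, latticeElt_add]
    exact lie_mem_wtSpace hu hv
  induction hu using Submodule.span_induction with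
  | zero => rw [zero_lie]; exact Submodule.zero_mem _
  | add a b _ _ ha hb => rw [add_lie]; exact Submodule.add_mem _ ha hb
  | smul r a _ ha => rw [smul_lie]; exact Submodule.smul_mem _ r ha
  | mem u hu =>
    induction hv using Submodule.span_induction with
    | zero => rw [lie_zero]; exact Submodule.zero_mem _
    | add a b _ _ ha hb => rw [lie_add]; exact Submodule.add_mem _ ha hb
    | smul r a _ ha => rw [lie_smul]; exact Submodule.smul_mem _ r ha
    | mem v hv =>
      rcases hu with ⟨x, rfl⟩ | ⟨s, hs, hu⟩ <;> rcases hv with ⟨y, rfl⟩ | ⟨t, ht, hv⟩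
      · by_cases hxy : x = y
        · subst hxy
          simp only [lie_self]
          exact Submodule.zero_mem _
        · refine hmix {x} {y} ⟨x, by simp, y, by simp, hxy⟩ _ _ ?_ ?_
          · rw [mwt_singleton]
            exact letter_mem_wtSpace x
          · rw [mwt_singleton]
            exact letter_mem_wtSpace y
      · refine hmix {x} t (add_comm t {x} ▸ ht.add_right _) _ _ ?_ hv
        rw [mwt_singleton]
        exact letter_mem_wtSpace x
      · refine hmix s {y} (hs.add_right _) _ _ hu ?_
        rw [mwt_singleton]
        exact letter_mem_wtSpace y
      · exact hmix s t (hs.add_right _) _ _ hu hv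

theorem nPlus_le_iSup {u : LieA} (hu : u ∈ nPlus) :
    u ∈ ⨆ α ∈ latticeElt '' freeWeights, wtSpace α := by
  have h1 : u ∈ letterSpan := by
    induction hu using LieSubalgebra.lieSpan_induction with
    | mem x h => exact Submodule.subset_span (Or.inl h)
    | zero => exact Submodule.zero_mem _
    | add x y _ _ h1 h2 => exact Submodule.add_mem _ h1 h2
    | smul a x _ h1 => exact Submodule.smul_mem _ a h1
    | lie x y _ _ h1 h2 => exact lie_mem_letterSpan h1 h2
  refine Submodule.span_le.2 ?_ h1
  rintro u (⟨x, rfl⟩ | ⟨s, hs, hu⟩)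
  · refine Submodule.mem_iSup_of_mem _ (Submodule.mem_iSup_of_mem
      ⟨x.wt, ⟨{x}, Or.inl ⟨x, rfl⟩, (mwt_singleton x).symm⟩, rfl⟩ (letter_mem_wtSpace x))
  · exact Submodule.mem_iSup_of_mem _ (Submodule.mem_iSup_of_mem ⟨mwt s, ⟨s, Or.inr hs, rfl⟩, rfl⟩
      hu)

/-- The set consisting of zero and the roots, in coordinates. -/
def rootsWithZero : Set (Index →₀ ℤ) :=
  {0, Finsupp.single reIndex 1, -Finsupp.single reIndex 1} ∪ (freeWeights ∪ -freeWeights)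

theorem mem_iSup_wtSpace (x : LieA) : x ∈ ⨆ α ∈ latticeElt '' rootsWithZero, wtSpace α := by
  have hle : ∀ μ ∈ rootsWithZero,
      wtSpace (latticeElt μ) ≤ ⨆ α ∈ latticeElt '' rootsWithZero, wtSpace α := fun μ hμ =>
    le_iSup₂_of_le (f := fun α (_ : α ∈ latticeElt '' rootsWithZero) => wtSpace α)
      (latticeElt μ) ⟨μ, hμ, rfl⟩ le_rfl
  have h1 : ∀ u ∈ nPlus, u ∈ ⨆ α ∈ latticeElt '' rootsWithZero, wtSpace α := by
    intro u hu
    have h2 : ⨆ α ∈ latticeElt '' freeWeights, wtSpace α ≤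
        ⨆ α ∈ latticeElt '' rootsWithZero, wtSpace α := by
      refine iSup₂_le ?_
      rintro _ ⟨μ, hμ, rfl⟩
      exact hle μ (Or.inr (Or.inl hμ))
    exact h2 (nPlus_le_iSup hu)
  have h2 : ∀ u ∈ nPlus, chev u ∈ ⨆ α ∈ latticeElt '' rootsWithZero, wtSpace α := by
    intro u hu
    have h3 : ⨆ α ∈ latticeElt '' freeWeights, wtSpace α ≤
        (⨆ α ∈ latticeElt '' rootsWithZero, wtSpace α).comap (chev : LieA →ₗ[ℂ] LieA) := by
      refine iSup₂_le ?_
      rintro _ ⟨μ, hμ, rfl⟩ y hy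
      refine hle (-μ) (Or.inr (Or.inr ?_)) ?_
      · simpa using hμ
      · rw [latticeElt_neg]
        exact chev_mem_wtSpace hy
    exact h3 (nPlus_le_iSup hu)
  have h3 : ∀ a ∈ gZero, a ∈ ⨆ α ∈ latticeElt '' rootsWithZero, wtSpace α := by
    refine fun a ha => Submodule.span_le.2 ?_ ha
    rintro a ((rfl | rfl) | ⟨i, rfl⟩)
    · refine hle (Finsupp.single reIndex 1) (Or.inl (by simp)) ?_
      rw [latticeElt_single, one_smul]
      exact e_mem_wtSpace _
    · refine hle (-Finsupp.single reIndex 1) (Or.inl (by simp)) ?_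
      rw [latticeElt_neg, latticeElt_single, one_smul]
      exact f_mem_wtSpace _
    · refine hle 0 (Or.inl (by simp)) ?_
      rw [latticeElt_zero]
      exact h_mem_wtSpace i
  obtain ⟨u, hu, a, ha, v, hv, rfl⟩ := exists_triangular x
  exact Submodule.add_mem _ (Submodule.add_mem _ (h1 u hu) (h3 a ha)) (h2 v hv)

theorem mem_rootsWithZero_of_mem_roots {μ : Index →₀ ℤ} (hμ : latticeElt μ ∈ roots) :
    μ ∈ rootsWithZero := by
  obtain ⟨-, x, hx, hx0⟩ := hμ
  obtain ⟨ν, hν, hνμ⟩ := mem_of_mem_iSup_wtSpace (mem_rootSpace_iff.1 hx) hx0 (mem_iSup_wtSpace x)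
  rwa [← latticeElt_injective hνμ]

/-! ### Nonvanishing brackets -/

theorem rep_xvec (l : ℕ) (i : ImIndex) : rep (xvec l i) = opX l i := by
  rw [xvec, map_ad_pow, rep_e_re, rep_e_im, ad_opE_pow]

/-- The vector of `𝔤(A)` corresponding to a letter. -/
def lvec (x : Letter) : LieA := xvec x.1.2 x.1.1

theorem rep_lvec (x : Letter) : rep (lvec x) = consOp x := by
  rw [lvec, rep_xvec, opX_eq_consOp]

theorem lvec_mem_nPlus (x : Letter) : lvec x ∈ nPlus := xvec_mem_nPlus _ _

/-- `nPlus` acts by iterated commutators of left multiplications, and these commute with right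
multiplications. -/
theorem rep_appendOp {u : LieA} (hu : u ∈ nPlus) (w : List Letter) (v : WordSpace Letter) :
    act (rep u) (appendOp w v) = appendOp w (act (rep u) v) := by
  induction hu using LieSubalgebra.lieSpan_induction generalizing v with
  | mem u h =>
    obtain ⟨x, rfl⟩ := h
    change act (rep (lvec x)) _ = appendOp w (act (rep (lvec x)) _)
    rw [rep_lvec, consOp_appendOp]
  | zero => simp
  | add u u' _ _ h1 h2 =>
    rw [map_add, map_add, LinearMap.add_apply, LinearMap.add_apply, map_add, h1, h2]
  | smul r u _ h1 =>
    rw [map_smul, map_smul, LinearMap.smul_apply, LinearMap.smul_apply, map_smul, h1]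
  | lie u u' _ _ h1 h2 =>
    rw [LieHom.map_lie, act_lie, act_lie, h2, h1, h1, h2, map_sub]

/-- The element of the tensor space corresponding to `u ∈ nPlus`. -/
def word (u : LieA) : WordSpace Letter := act (rep u) vac

/-- In the tensor algebra this is `x ⊗ u - u ⊗ x`. -/
theorem word_lie_lvec (x : Letter) {u : LieA} (hu : u ∈ nPlus) :
    word ⁅lvec x, u⁆ =
      Finsupp.mapDomain (List.cons x) (word u) - Finsupp.mapDomain (· ++ [x]) (word u) := by
  have h1 : act (consOp x) vac = appendOp [x] vac := by
    rw [vac, act_consOp_single, appendOp_single, List.nil_append]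
  rw [word, LieHom.map_lie, act_lie, rep_lvec, h1, rep_appendOp hu]
  rfl

theorem mapDomain_append_ne {x y : Letter} (hxy : x ≠ y) (v : WordSpace Letter)
    (w : List Letter) : Finsupp.mapDomain (· ++ [x]) v (w ++ [y]) = 0 := by
  refine Finsupp.mapDomain_of_notMem_range _ _ ?_
  rintro ⟨w', hw'⟩
  have := (List.append_inj' hw' rfl).2
  simp only [List.cons.injEq, and_true] at this
  exact hxy this

theorem mapDomain_cons_ne {x y : Letter} (hxy : x ≠ y) (v : WordSpace Letter)
    (w : List Letter) : Finsupp.mapDomain (List.cons x) v (y :: w) = 0 := by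
  refine Finsupp.mapDomain_of_notMem_range _ _ ?_
  rintro ⟨w', hw'⟩
  exact hxy (List.cons.inj hw').1

theorem mapDomain_append_self (x : Letter) (v : WordSpace Letter)
    (w : List Letter) : Finsupp.mapDomain (· ++ [x]) v (w ++ [x]) = v w :=
  Finsupp.mapDomain_apply (f := (· ++ [x])) (List.append_left_injective [x]) v w

theorem mapDomain_cons_self (x : Letter) (v : WordSpace Letter)
    (w : List Letter) : Finsupp.mapDomain (List.cons x) v (x :: w) = v w :=
  Finsupp.mapDomain_apply List.cons_injective v w

theorem lvec_mem_wtSpace (x : Letter) : lvec x ∈ wtSpace (latticeElt (mwt {x})) := by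
  rw [mwt_singleton]
  exact letter_mem_wtSpace x

theorem lie_lvec_mem_wtSpace (x : Letter) {s : Multiset Letter} {u : LieA}
    (hu : u ∈ wtSpace (latticeElt (mwt s))) :
    ⁅lvec x, u⁆ ∈ wtSpace (latticeElt (mwt (x ::ₘ s))) := by
  rw [← Multiset.singleton_add, mwt_add, latticeElt_add]
  exact lie_mem_wtSpace (lvec_mem_wtSpace x) hu

/-- The vector is `(ad x)^k y`. In the word `x⋯xy` only the term `x ⊗ u` contributes, since all
words of `u ⊗ x` end in `x`. -/
theorem exists_word_replicate {x y : Letter} (hxy : x ≠ y) (k : ℕ) :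
    ∃ u ∈ nPlus, u ∈ wtSpace (latticeElt (mwt (Multiset.replicate k x + {y}))) ∧
      word u (List.replicate k x ++ [y]) ≠ 0 := by
  induction k with
  | zero =>
    refine ⟨lvec y, lvec_mem_nPlus y, ?_, ?_⟩
    · rw [Multiset.replicate_zero, zero_add]
      exact lvec_mem_wtSpace y
    · rw [word, rep_lvec, vac, act_consOp_single]
      simp
  | succ k ih =>
    obtain ⟨u, hu, hw, hne⟩ := ih
    refine ⟨⁅lvec x, u⁆, nPlus.lie_mem (lvec_mem_nPlus x) hu, ?_, ?_⟩
    · rw [Multiset.replicate_succ, Multiset.cons_add]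
      exact lie_lvec_mem_wtSpace x hw
    · rw [word_lie_lvec x hu, Finsupp.sub_apply, mapDomain_append_ne hxy, sub_zero,
        List.replicate_succ, List.cons_append, mapDomain_cons_self]
      exact hne

/-- Bracket the remaining letters `z ≠ x` one by one onto `(ad x)^(k+1) y`. A word starting with `x`
survives: `-u ⊗ z` lengthens it on the right, while all words of `z ⊗ u` start with `z`. -/
theorem exists_word_mixed {x y : Letter} (hxy : x ≠ y) (k : ℕ) (t : Multiset Letter)
    (ht : ∀ z ∈ t, z ≠ x) :
    ∃ u ∈ nPlus, u ∈ wtSpace (latticeElt (mwt (t + (Multiset.replicate (k + 1) x + {y})))) ∧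
      ∃ w, word u (x :: w) ≠ 0 := by
  induction t using Multiset.induction_on with
  | empty =>
    obtain ⟨u, hu, hw, hne⟩ := exists_word_replicate hxy (k + 1)
    refine ⟨u, hu, by rwa [zero_add], List.replicate k x ++ [y], ?_⟩
    rwa [List.replicate_succ] at hne
  | cons z t ih =>
    obtain ⟨u, hu, hw, w, hne⟩ := ih fun z' hz' => ht z' (Multiset.mem_cons_of_mem hz')
    refine ⟨⁅lvec z, u⁆, nPlus.lie_mem (lvec_mem_nPlus z) hu, ?_, w ++ [z], ?_⟩
    · rw [Multiset.cons_add]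
      exact lie_lvec_mem_wtSpace z hw
    · rw [word_lie_lvec z hu, Finsupp.sub_apply,
        mapDomain_cons_ne (ht z (Multiset.mem_cons_self z t)), zero_sub, ← List.cons_append,
        mapDomain_append_self]
      exact neg_ne_zero.2 hne

theorem exists_weight_vector {s : Multiset Letter} (hs : (∃ x, s = {x}) ∨ Mixed s) :
    ∃ u ∈ wtSpace (latticeElt (mwt s)), u ≠ 0 := by
  classical
  rcases hs with ⟨x, rfl⟩ | ⟨x, hx, y, hy, hxy⟩
  · refine ⟨lvec x, lvec_mem_wtSpace x, fun h0 => consOp_ne_zero x ?_⟩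
    rw [← rep_lvec, h0, map_zero]
  · obtain ⟨k, hk⟩ : ∃ k, s.count x = k + 1 :=
      Nat.exists_eq_succ_of_ne_zero (Multiset.count_ne_zero.2 hx)
    have hy' : y ∈ s.filter (· ≠ x) := Multiset.mem_filter.2 ⟨hy, hxy.symm⟩
    obtain ⟨t, ht⟩ := Multiset.exists_cons_of_mem hy'
    -- Split off all copies of `x` and a single `y`; further copies of `y` may remain in `t`.
    have hs : s = t + (Multiset.replicate (k + 1) x + {y}) := by
      conv_lhs => rw [← Multiset.filter_add_not (· ≠ x) s, ht]
      simp only [ne_eq, not_not]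
      rw [Multiset.filter_eq', hk, ← Multiset.singleton_add]
      abel
    obtain ⟨u, -, hw, w, hne⟩ := exists_word_mixed hxy k t fun z hz =>
      (Multiset.mem_filter.1 (ht ▸ Multiset.mem_cons_of_mem hz :)).2
    refine ⟨u, hs ▸ hw, ?_⟩
    rintro rfl
    simp [word] at hne

/-! ### The roots -/

/-- The element `ℓ α_{-1} + ∑ c_{jk} α_{jk}` of the root lattice. -/
def lat (l : ℤ) (c : ImIndex →₀ ℤ) : Index →₀ ℤ :=
  Finsupp.single reIndex l + c.mapDomain Subtype.val

theorem lat_re (l : ℤ) (c : ImIndex →₀ ℤ) : lat l c reIndex = l := by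
  rw [lat, Finsupp.add_apply, Finsupp.single_eq_same, Finsupp.mapDomain_of_notMem_range, add_zero]
  rintro ⟨i, hi⟩
  exact ImIndex.ne_reIndex i hi

theorem lat_im (l : ℤ) (c : ImIndex →₀ ℤ) (i : ImIndex) : lat l c i.1 = c i := by
  rw [lat, Finsupp.add_apply, Finsupp.mapDomain_apply Subtype.val_injective,
    Finsupp.single_eq_of_ne i.ne_reIndex, zero_add]

theorem lat_add (l l' : ℤ) (c c' : ImIndex →₀ ℤ) : lat (l + l') (c + c') = lat l c + lat l' c' := by
  rw [lat, lat, lat, Finsupp.single_add, Finsupp.mapDomain_add]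
  abel

theorem lat_zero : lat 0 0 = 0 := by simp [lat]

theorem lat_neg (l : ℤ) (c : ImIndex →₀ ℤ) : lat (-l) (-c) = -lat l c := by
  rw [eq_neg_iff_add_eq_zero, ← lat_add, neg_add_cancel, neg_add_cancel, lat_zero]

theorem lat_inj {l l' : ℤ} {c c' : ImIndex →₀ ℤ} (h : lat l c = lat l' c') : l = l' ∧ c = c' := by
  refine ⟨by rw [← lat_re l c, h, lat_re], ?_⟩
  ext i
  rw [← lat_im l c, h, lat_im]

theorem latticeElt_lat (l : ℤ) (c : ImIndex →₀ ℤ) :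
    latticeElt (lat l c) = l • αre + c.sum fun i n => n • αim i := by
  rw [lat, latticeElt_add, latticeElt_single, latticeElt, Finsupp.sum_mapDomain_index]
  · rfl
  · intro; rw [zero_smul]
  · intro _ _ _; rw [add_smul]

/-- The coefficient of `α_{-1}` in the weight of a multiset of letters. -/
def mlen (s : Multiset Letter) : ℕ := (s.map fun x => x.1.2).sum

/-- The imaginary part of the weight of a multiset of letters. -/
def mim (s : Multiset Letter) : ImIndex →₀ ℤ := (s.map fun x => Finsupp.single x.1.1 1).sum

theorem mlen_cons (x : Letter) (s : Multiset Letter) : mlen (x ::ₘ s) = x.1.2 + mlen s := by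
  simp [mlen]

theorem mim_cons (x : Letter) (s : Multiset Letter) :
    mim (x ::ₘ s) = Finsupp.single x.1.1 1 + mim s := by
  simp [mim]

theorem mlen_add (s t : Multiset Letter) : mlen (s + t) = mlen s + mlen t := by simp [mlen]
theorem mim_add (s t : Multiset Letter) : mim (s + t) = mim s + mim t := by simp [mim]

theorem mwt_eq_lat (s : Multiset Letter) : mwt s = lat (mlen s) (mim s) := by
  induction s using Multiset.induction_on with
  | empty => simp [mwt, mlen, mim, lat]
  | cons x s ih =>
    rw [← Multiset.singleton_add, mwt_add, ih, mwt_singleton, Multiset.singleton_add, mlen_cons,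
      mim_cons, Nat.cast_add, lat_add]
    congr 1
    rw [Letter.wt, lat, Finsupp.mapDomain_single]

theorem mim_nonneg (s : Multiset Letter) (i : ImIndex) : 0 ≤ mim s i := by
  classical
  induction s using Multiset.induction_on with
  | empty => simp [mim]
  | cons x s ih =>
    rw [mim_cons, Finsupp.add_apply, Finsupp.single_apply]
    split_ifs <;> omega

theorem mim_pos_of_mem {s : Multiset Letter} {x : Letter} (hx : x ∈ s) : 0 < mim s x.1.1 := by
  obtain ⟨t, rfl⟩ := Multiset.exists_cons_of_mem hx
  rw [mim_cons, Finsupp.add_apply, Finsupp.single_eq_same]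
  have := mim_nonneg t x.1.1
  omega

theorem exists_mem_of_mim_ne_zero {s : Multiset Letter} {i : ImIndex} (h : mim s i ≠ 0) :
    ∃ x ∈ s, x.1.1 = i := by
  classical
  induction s using Multiset.induction_on with
  | empty => simp [mim] at h
  | cons x s ih =>
    by_cases hx : x.1.1 = i
    · exact ⟨x, Multiset.mem_cons_self x s, hx⟩
    · rw [mim_cons, Finsupp.add_apply, Finsupp.single_apply, if_neg hx, zero_add] at h
      obtain ⟨y, hy, hyi⟩ := ih h
      exact ⟨y, Multiset.mem_cons_of_mem hy, hyi⟩

theorem latticeElt_mem_roots_of_freeWeights {μ : Index →₀ ℤ} (hμ : μ ∈ freeWeights) :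
    latticeElt μ ∈ roots := by
  obtain ⟨s, hs, rfl⟩ := hμ
  obtain ⟨u, hu, hne⟩ := exists_weight_vector hs
  refine ⟨?_, u, mem_rootSpace_iff.2 hu, hne⟩
  rw [← latticeElt_zero]
  refine latticeElt_injective.ne ?_
  obtain ⟨x, hx⟩ : ∃ x, x ∈ s := by
    rcases hs with ⟨x, rfl⟩ | ⟨x, hx, -⟩
    · exact ⟨x, Multiset.mem_singleton_self x⟩
    · exact ⟨x, hx⟩
  intro h0
  have h1 := mim_pos_of_mem hx
  rw [← lat_im (mlen s), ← mwt_eq_lat, h0] at h1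
  exact lt_irrefl _ h1

theorem neg_mem_roots {α : Module.Dual ℂ he} (hα : α ∈ roots) : -α ∈ roots := by
  obtain ⟨h0, x, hx, hx0⟩ := hα
  exact ⟨neg_ne_zero.2 h0, chev x, mem_rootSpace_iff.2 (chev_mem_wtSpace (mem_rootSpace_iff.1 hx)),
    chev_ne_zero hx0⟩

theorem neg_mem_roots_iff {α : Module.Dual ℂ he} : -α ∈ roots ↔ α ∈ roots :=
  ⟨fun h => neg_neg α ▸ neg_mem_roots h, neg_mem_roots⟩

theorem αre_mem_roots : αre ∈ roots := by
  refine ⟨?_, e reIndex, mem_rootSpace_iff.2 (e_mem_wtSpace _), e_ne_zero _⟩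
  intro h0
  have h1 : latticeElt (Finsupp.single reIndex 1) = latticeElt 0 := by
    rw [latticeElt_zero, latticeElt_single, one_smul]
    exact h0
  simpa using latticeElt_injective h1

theorem latticeElt_mem_roots_iff (μ : Index →₀ ℤ) :
    latticeElt μ ∈ roots ↔ (μ = Finsupp.single reIndex 1 ∨ μ = -Finsupp.single reIndex 1) ∨
      μ ∈ freeWeights ∨ -μ ∈ freeWeights := by
  constructor
  · intro h
    rcases mem_rootsWithZero_of_mem_roots h with (rfl | h') | h'
    · exact absurd latticeElt_zero h.1
    · exact Or.inl h'
    · exact Or.inr h'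
  · have hre : latticeElt (Finsupp.single reIndex 1) = αre := by
      rw [latticeElt_single, one_smul, αre]
    rintro ((rfl | rfl) | h | h)
    · rw [hre]
      exact αre_mem_roots
    · rw [latticeElt_neg, hre]
      exact neg_mem_roots αre_mem_roots
    · exact latticeElt_mem_roots_of_freeWeights h
    · rw [← neg_mem_roots_iff, ← latticeElt_neg]
      exact latticeElt_mem_roots_of_freeWeights h

/-! ### Numerical description of the weights -/

/-- The largest multiple of `α_{-1}` occurring in a weight with imaginary part `c`. -/
def maxLen (c : ImIndex →₀ ℤ) : ℤ := c.sum fun i n => (i.deg - 1) * n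

theorem maxLen_add (c c' : ImIndex →₀ ℤ) : maxLen (c + c') = maxLen c + maxLen c' :=
  Finsupp.sum_add_index' (fun _ => mul_zero _) fun _ _ _ => mul_add _ _ _

theorem maxLen_single (i : ImIndex) (n : ℤ) : maxLen (Finsupp.single i n) = (i.deg - 1) * n :=
  Finsupp.sum_single_index (mul_zero _)

theorem mlen_le_maxLen (s : Multiset Letter) : (mlen s : ℤ) ≤ maxLen (mim s) := by
  induction s using Multiset.induction_on with
  | empty => simp [mlen, maxLen, mim]
  | cons x s ih =>
    rw [mlen_cons, mim_cons, maxLen_add, maxLen_single]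
    have := x.2
    push_cast
    omega

theorem mlen_lt_maxLen {s : Multiset Letter} {x : Letter} (hx : x ∈ s)
    (hlt : (x.1.2 : ℤ) + 1 < x.1.1.deg) : (mlen s : ℤ) < maxLen (mim s) := by
  obtain ⟨t, rfl⟩ := Multiset.exists_cons_of_mem hx
  rw [mlen_cons, mim_cons, maxLen_add, maxLen_single]
  have := mlen_le_maxLen t
  push_cast
  omega

theorem mlen_pos {s : Multiset Letter} {x : Letter} (hx : x ∈ s) (hlt : 0 < x.1.2) :
    0 < mlen s := by
  obtain ⟨t, rfl⟩ := Multiset.exists_cons_of_mem hx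
  rw [mlen_cons]
  omega

/-- If every letter had the top exponent `deg - 1`, the total would already be maximal. -/
theorem exists_lt_deg_of_mlen_lt {s : Multiset Letter} (h : (mlen s : ℤ) < maxLen (mim s)) :
    ∃ x ∈ s, (x.1.2 : ℤ) + 1 < x.1.1.deg := by
  by_contra! hcon
  refine h.not_ge ?_
  clear h
  induction s using Multiset.induction_on with
  | empty => simp [mlen, maxLen, mim]
  | cons x s ih =>
    rw [mlen_cons, mim_cons, maxLen_add, maxLen_single]
    have h1 := ih fun y hy => hcon y (Multiset.mem_cons_of_mem hy)
    have h2 := hcon x (Multiset.mem_cons_self x s)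
    push_cast
    omega

theorem exists_multiset_zero (c : ImIndex →₀ ℕ) :
    ∃ s, mlen s = 0 ∧ mim s = c.mapRange (Nat.cast : ℕ → ℤ) Nat.cast_zero := by
  induction c using Finsupp.induction_linear with
  | zero => exact ⟨0, by simp [mlen], by simp [mim]⟩
  | add c c' h h' =>
    obtain ⟨s, hs, hs'⟩ := h
    obtain ⟨t, ht, ht'⟩ := h'
    refine ⟨s + t, by rw [mlen_add, hs, ht], ?_⟩
    rw [mim_add, hs', ht', Finsupp.mapRange_add fun a b => Nat.cast_add a b]
  | single i n =>
    have hi := i.2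
    refine ⟨Multiset.replicate n ⟨(i, 0), by change 1 ≤ i.deg at hi; push_cast; omega⟩, ?_, ?_⟩
    · simp [mlen]
    · simp [mim]

/-- Start with all exponents `0` and raise one exponent by `1` at each step. -/
theorem exists_multiset {c : ImIndex →₀ ℤ} (hc : ∀ i, 0 ≤ c i) (l : ℕ)
    (hl : (l : ℤ) ≤ maxLen c) : ∃ s, mlen s = l ∧ mim s = c := by
  induction l with
  | zero =>
    obtain ⟨s, hs, hs'⟩ := exists_multiset_zero (c.mapRange Int.toNat rfl)
    refine ⟨s, hs, hs'.trans ?_⟩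
    ext i
    simp [hc i]
  | succ l ih =>
    push_cast at hl
    obtain ⟨s, hs, rfl⟩ := ih (by omega)
    obtain ⟨x, hx, hlt⟩ := exists_lt_deg_of_mlen_lt (s := s) (by omega)
    obtain ⟨t, rfl⟩ := Multiset.exists_cons_of_mem hx
    refine ⟨⟨(x.1.1, x.1.2 + 1), by push_cast; omega⟩ ::ₘ t, ?_, ?_⟩
    · rw [mlen_cons] at hs ⊢
      change x.1.2 + 1 + mlen t = l + 1
      omega
    · rw [mim_cons, mim_cons]

/-- The numerical conditions on `ℓ` and `c` for `ℓ α_{-1} + ∑ c_{jk} α_{jk}` to be a positive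
imaginary root. -/
def IsImWeight (l : ℤ) (c : ImIndex →₀ ℤ) : Prop :=
  (0 ≤ l ∧ (∀ i, 0 ≤ c i) ∧ ∃ i, 0 < c i) ∧ l ≤ maxLen c ∧
    ∀ i, (∀ p, c p ≠ 0 ↔ p = i) → c i = 1 ∨ (0 < l ∧ l < (i.deg - 1) * c i)

theorem eq_single_of_support {c : ImIndex →₀ ℤ} {i : ImIndex} (h : ∀ p, c p ≠ 0 ↔ p = i) :
    c = Finsupp.single i (c i) := by
  classical
  ext p
  rw [Finsupp.single_apply]
  split_ifs with hp
  · rw [hp]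
  · by_contra hne
    exact hp ((h p).1 hne).symm

theorem letter_ext {x y : Letter} (h1 : x.1.1 = y.1.1) (h2 : x.1.2 = y.1.2) : x = y :=
  Subtype.ext (Prod.ext h1 h2)

theorem isImWeight_of_multiset {s : Multiset Letter} (hs : (∃ x, s = {x}) ∨ Mixed s) :
    IsImWeight (mlen s) (mim s) := by
  refine ⟨⟨Int.natCast_nonneg _, mim_nonneg s, ?_⟩, mlen_le_maxLen s, fun i hi => ?_⟩
  · rcases hs with ⟨x, rfl⟩ | ⟨x, hx, -⟩
    · exact ⟨_, mim_pos_of_mem (Multiset.mem_singleton_self x)⟩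
    · exact ⟨_, mim_pos_of_mem hx⟩
  · have hmem : ∀ x ∈ s, x.1.1 = i := fun x hx => (hi _).1 (mim_pos_of_mem hx).ne'
    rcases hs with ⟨x, rfl⟩ | ⟨x, hx, y, hy, hxy⟩
    · left
      rw [← hmem x (Multiset.mem_singleton_self x)]
      simp [mim]
    · right
      rw [← maxLen_single, ← eq_single_of_support hi]
      have hx' := hmem x hx
      have hy' := hmem y hy
      have hne : x.1.2 ≠ y.1.2 := fun h => hxy (letter_ext (hx'.trans hy'.symm) h)
      have hxd := x.2
      have hyd := y.2
      rw [hx'] at hxd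
      rw [hy'] at hyd
      -- Of two different letters over `i`, the larger exponent is positive and the smaller is not
      -- the top one, so both inequalities are strict.
      rcases lt_or_gt_of_ne hne with h | h
      · exact ⟨by exact_mod_cast mlen_pos hy (by omega), mlen_lt_maxLen hx (by rw [hx']; omega)⟩
      · exact ⟨by exact_mod_cast mlen_pos hx (by omega), mlen_lt_maxLen hy (by rw [hy']; omega)⟩

theorem exists_multiset_of_isImWeight {l : ℤ} {c : ImIndex →₀ ℤ} (h : IsImWeight l c) :
    ∃ s, ((∃ x, s = {x}) ∨ Mixed s) ∧ (mlen s : ℤ) = l ∧ mim s = c := by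
  obtain ⟨⟨hl, hc, i, hi⟩, hle, h3⟩ := h
  lift l to ℕ using hl
  obtain ⟨s, rfl, rfl⟩ := exists_multiset hc l hle
  by_cases hs : Mixed s
  · exact ⟨s, Or.inr hs, rfl, rfl⟩
  obtain ⟨x, hx, rfl⟩ := exists_mem_of_mim_ne_zero hi.ne'
  -- A multiset that is not mixed repeats a single letter. With at least two copies, condition (iii)
  -- puts its exponent strictly between the extremes.
  have hrep : s = Multiset.replicate s.card x := by
    refine Multiset.eq_replicate_card.2 fun y hy => ?_
    by_contra hne
    exact hs ⟨y, hy, x, hx, hne⟩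
  generalize s.card = n at hrep
  subst hrep
  have hmim : mim (Multiset.replicate n x) = Finsupp.single x.1.1 (n : ℤ) := by simp [mim]
  have hmlen : mlen (Multiset.replicate n x) = n * x.1.2 := by simp [mlen]
  have hn0 : n ≠ 0 := by
    rintro rfl
    simp at hx
  rcases n with _ | _ | n
  · exact absurd rfl hn0
  · exact ⟨_, Or.inl ⟨x, Multiset.replicate_one x⟩, rfl, rfl⟩
  have h4 := h3 x.1.1 fun p => by
    classical
    rw [hmim, Finsupp.single_apply]
    constructor
    · intro h
      by_contra hne
      exact h (if_neg fun h => hne h.symm)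
    · rintro rfl
      rw [if_pos rfl]
      exact_mod_cast hn0
  rw [hmim, hmlen, Finsupp.single_eq_same] at h4
  obtain ⟨h5, h6⟩ := h4.resolve_left (by push_cast; omega)
  have h7 : 0 < x.1.2 := by
    rcases Nat.eq_zero_or_pos x.1.2 with h | h
    · rw [h] at h5
      simp at h5
    · exact h
  have h8 : (x.1.2 : ℤ) + 1 < x.1.1.deg := by
    push_cast at h6
    nlinarith
  -- Replace two copies of `x` by letters with exponents shifted by `-1` and `+1`: the weight is
  -- unchanged and the multiset becomes mixed.
  let y : Letter := ⟨(x.1.1, x.1.2 - 1), by have := x.2; push_cast; omega⟩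
  let z : Letter := ⟨(x.1.1, x.1.2 + 1), by push_cast; omega⟩
  refine ⟨y ::ₘ z ::ₘ Multiset.replicate n x, Or.inr ⟨y, by simp, z, by simp, ?_⟩, ?_, ?_⟩
  · intro h
    have h' : x.1.2 - 1 = x.1.2 + 1 := congrArg (fun u : Letter => u.1.2) h
    omega
  · rw [Multiset.replicate_succ, Multiset.replicate_succ, mlen_cons, mlen_cons, mlen_cons,
      mlen_cons]
    change ((x.1.2 - 1 + (x.1.2 + 1 + _) : ℕ) : ℤ) = _
    omega
  · rw [Multiset.replicate_succ, Multiset.replicate_succ, mim_cons, mim_cons, mim_cons, mim_cons]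

theorem lat_mem_freeWeights_iff (l : ℤ) (c : ImIndex →₀ ℤ) :
    lat l c ∈ freeWeights ↔ IsImWeight l c := by
  constructor
  · rintro ⟨s, hs, h⟩
    rw [mwt_eq_lat] at h
    obtain ⟨rfl, rfl⟩ := lat_inj h
    exact isImWeight_of_multiset hs
  · intro h
    obtain ⟨s, hs, rfl, rfl⟩ := exists_multiset_of_isImWeight h
    exact ⟨s, hs, (mwt_eq_lat s).symm⟩

theorem latticeElt_lat_mem_roots_iff (l : ℤ) (c : ImIndex →₀ ℤ) :
    latticeElt (lat l c) ∈ roots ↔ (c = 0 ∧ (l = 1 ∨ l = -1)) ∨ IsImWeight l c ∨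
      IsImWeight (-l) (-c) := by
  rw [latticeElt_mem_roots_iff, ← lat_neg, lat_mem_freeWeights_iff, lat_mem_freeWeights_iff]
  refine or_congr_left ?_
  have h1 : Finsupp.single reIndex 1 = lat 1 0 := by simp [lat]
  rw [h1, ← lat_neg, neg_zero]
  constructor
  · rintro (h | h)
    · obtain ⟨rfl, rfl⟩ := lat_inj h
      exact ⟨rfl, Or.inl rfl⟩
    · obtain ⟨rfl, rfl⟩ := lat_inj h
      exact ⟨rfl, Or.inr rfl⟩
  · rintro ⟨rfl, rfl | rfl⟩
    · exact Or.inl rfl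
    · exact Or.inr rfl

/-! ### Positive imaginary roots -/

/-- The Gram matrix `-(i + p)` has rank at most two, so the form is a product of two linear
functionals. -/
theorem latticeForm_self (a : Index →₀ ℤ) :
    latticeForm a a = -2 * ((a.sum fun _ n => n) * a.sum fun i n => i.deg * n) := by
  have h1 : ∀ i p : Index, a i * a p * cartan i p =
      -(a p * (i.deg * a i)) + -(a i * (p.deg * a p)) := fun i p => by
    rw [cartan]
    ring
  simp only [latticeForm, Finsupp.sum, h1, Finset.sum_add_distrib, Finset.sum_neg_distrib]
  rw [Finset.sum_comm, ← Finset.sum_mul_sum]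
  ring

theorem lat_sum (l : ℤ) (c : ImIndex →₀ ℤ) :
    ((lat l c).sum fun _ n => n) = l + c.sum fun _ n => n := by
  rw [lat, Finsupp.sum_add_index' (fun _ => rfl) (fun _ _ _ => rfl), Finsupp.sum_single_index rfl,
    Finsupp.sum_mapDomain_index (fun _ => rfl) (fun _ _ _ => rfl)]

theorem lat_sum_deg (l : ℤ) (c : ImIndex →₀ ℤ) :
    ((lat l c).sum fun i n => i.deg * n) = -l + (maxLen c + c.sum fun _ n => n) := by
  rw [lat, Finsupp.sum_add_index' (fun _ => mul_zero _) (fun _ _ _ => mul_add _ _ _),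
    Finsupp.sum_single_index (mul_zero _),
    Finsupp.sum_mapDomain_index (fun _ => mul_zero _) (fun _ _ _ => mul_add _ _ _), reIndex_deg,
    maxLen, ← Finsupp.sum_add]
  exact congrArg₂ (· + ·) (neg_one_mul l) (Finsupp.sum_congr fun i _ => by ring)

theorem IsImWeight.latticeForm_nonpos {l : ℤ} {c : ImIndex →₀ ℤ} (h : IsImWeight l c) :
    latticeForm (lat l c) (lat l c) ≤ 0 := by
  obtain ⟨⟨hl, hc, -⟩, hle, -⟩ := h
  have h1 : 0 ≤ c.sum fun _ n => n := Finset.sum_nonneg fun i _ => hc i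
  rw [latticeForm_self, lat_sum, lat_sum_deg]
  have := mul_nonneg (add_nonneg hl h1)
    (show 0 ≤ -l + (maxLen c + c.sum fun _ n => n) by omega)
  linarith

theorem latticeForm_re (l : ℤ) : latticeForm (lat l 0) (lat l 0) = 2 * (l * l) := by
  rw [latticeForm_self, lat_sum, lat_sum_deg]
  simp [maxLen]

theorem mem_positive_imaginary_iff (l : ℤ) (c : ImIndex →₀ ℤ) :
    latticeElt (lat l c) ∈ positiveRoots ∩ imaginaryRoots ↔ IsImWeight l c := by
  constructor
  · rintro ⟨⟨hr, a, ha, hpos⟩, -, b, hb, hform⟩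
    obtain rfl := latticeElt_injective ha
    obtain rfl := latticeElt_injective hb
    rcases (latticeElt_lat_mem_roots_iff l c).1 hr with ⟨rfl, h⟩ | h | h
    · rw [latticeForm_re] at hform
      rcases h with rfl | rfl <;> norm_num at hform
    · exact h
    · obtain ⟨⟨-, -, i, hi⟩, -⟩ := h
      have := hpos i.1
      rw [lat_im] at this
      rw [Finsupp.neg_apply] at hi
      omega
  · intro h
    have hr := (latticeElt_lat_mem_roots_iff l c).2 (Or.inr (Or.inl h))
    refine ⟨⟨hr, _, rfl, fun i => ?_⟩, hr, _, rfl, h.latticeForm_nonpos⟩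
    obtain ⟨⟨hl, hc, -⟩, -⟩ := h
    rcases deg_cases i with rfl | hi
    · rwa [lat_re]
    · exact (lat_im l c ⟨i, hi⟩).symm ▸ hc _

/-! ### Roots involving at most two imaginary simple roots -/

theorem isImWeight_single_iff (i : ImIndex) (l a : ℤ) :
    IsImWeight l (Finsupp.single i a) ↔
      0 ≤ l ∧ 0 < a ∧ l ≤ (i.deg - 1) * a ∧ (a = 1 ∨ (0 < l ∧ l < (i.deg - 1) * a)) := by
  classical
  have hsupp : a ≠ 0 → ∀ p, (Finsupp.single i a : ImIndex →₀ ℤ) p ≠ 0 ↔ p = i := fun ha p => by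
    rw [Finsupp.single_apply_ne_zero]
    exact and_iff_left ha
  rw [IsImWeight, maxLen_single]
  constructor
  · rintro ⟨⟨hl, hc, p, hp⟩, hle, h3⟩
    have ha : 0 < a := by
      rw [Finsupp.single_apply] at hp
      split_ifs at hp
      · exact hp
      · exact absurd hp (lt_irrefl _)
    refine ⟨hl, ha, hle, ?_⟩
    simpa using h3 i (hsupp ha.ne')
  · rintro ⟨hl, ha, hle, h3⟩
    refine ⟨⟨hl, fun p => ?_, i, by simpa using ha⟩, hle, fun p hp => ?_⟩
    · rw [Finsupp.single_apply]
      split_ifs <;> omega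
    · obtain rfl := (hp i).1 (by simpa using ha.ne')
      simpa using h3

/-- With two indices in the support, the condition on a single nonzero coefficient is vacuous. -/
theorem isImWeight_pair_iff {i p : ImIndex} (hip : i ≠ p) {a b : ℤ} (ha : 1 ≤ a) (hb : 1 ≤ b)
    (l : ℤ) : IsImWeight l (Finsupp.single i a + Finsupp.single p b) ↔
      0 ≤ l ∧ l ≤ (i.deg - 1) * a + (p.deg - 1) * b := by
  classical
  have hi : (Finsupp.single i a + Finsupp.single p b : ImIndex →₀ ℤ) i = a := by
    simp [hip.symm]
  have hp : (Finsupp.single i a + Finsupp.single p b : ImIndex →₀ ℤ) p = b := by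
    simp [hip]
  rw [IsImWeight, maxLen_add, maxLen_single, maxLen_single]
  constructor
  · rintro ⟨⟨hl, -⟩, hle, -⟩
    exact ⟨hl, hle⟩
  · rintro ⟨hl, hle⟩
    refine ⟨⟨hl, fun q => ?_, i, by rw [hi]; omega⟩, hle, fun q hq => ?_⟩
    · rw [Finsupp.add_apply, Finsupp.single_apply, Finsupp.single_apply]
      split_ifs <;> omega
    · exact absurd (((hq i).1 (by rw [hi]; omega)).trans ((hq p).1 (by rw [hp]; omega)).symm) hip

theorem latticeElt_lat_single (l a : ℤ) (i : ImIndex) :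
    latticeElt (lat l (Finsupp.single i a)) = l • αre + a • αim i := by
  rw [latticeElt_lat, Finsupp.sum_single_index (by rw [zero_smul])]

theorem latticeElt_lat_pair (l a b : ℤ) (i p : ImIndex) :
    latticeElt (lat l (Finsupp.single i a + Finsupp.single p b)) =
      l • αre + a • αim i + b • αim p := by
  rw [latticeElt_lat, Finsupp.sum_add_index' (fun _ => by rw [zero_smul])
      (fun _ _ _ => by rw [add_smul]),
    Finsupp.sum_single_index (by rw [zero_smul]),
    Finsupp.sum_single_index (by rw [zero_smul]), add_assoc]

theorem re_mem_roots_iff (l : ℤ) : l • αre ∈ roots ↔ l = 1 ∨ l = -1 := by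
  have h1 : l • αre = latticeElt (lat l 0) := by simp [latticeElt_lat]
  rw [h1, latticeElt_lat_mem_roots_iff]
  constructor
  · rintro (h | ⟨⟨-, -, i, hi⟩, -⟩ | ⟨⟨-, -, i, hi⟩, -⟩)
    · exact h.2
    · simp at hi
    · simp at hi
  · exact fun h => Or.inl ⟨rfl, h⟩

theorem single_mem_roots_iff (i : ImIndex) (l : ℤ) {a : ℤ} (ha : 1 ≤ a) :
    l • αre + a • αim i ∈ roots ↔
      (a = 1 ∧ 0 ≤ l ∧ l ≤ i.deg - 1) ∨ (0 < l ∧ l < (i.deg - 1) * a) := by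
  rw [← latticeElt_lat_single, latticeElt_lat_mem_roots_iff, isImWeight_single_iff,
    ← Finsupp.single_neg, isImWeight_single_iff, Finsupp.single_eq_zero]
  constructor
  · rintro (h | ⟨h1, -, h2, rfl | h3⟩ | h)
    · omega
    · left
      omega
    · exact Or.inr h3
    · omega
  · rintro (⟨rfl, h1, h2⟩ | h)
    · exact Or.inr (Or.inl ⟨h1, one_pos, by omega, Or.inl rfl⟩)
    · exact Or.inr (Or.inl ⟨h.1.le, by omega, h.2.le, Or.inr h⟩)

theorem pair_mem_roots_iff {i p : ImIndex} (hip : i ≠ p) (l : ℤ) {a b : ℤ} (ha : 1 ≤ a)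
    (hb : 1 ≤ b) : l • αre + a • αim i + b • αim p ∈ roots ↔
      0 ≤ l ∧ l ≤ (i.deg - 1) * a + (p.deg - 1) * b := by
  classical
  have hi : (Finsupp.single i a + Finsupp.single p b : ImIndex →₀ ℤ) i = a := by
    simp [hip.symm]
  rw [← latticeElt_lat_pair, latticeElt_lat_mem_roots_iff, isImWeight_pair_iff hip ha hb]
  constructor
  · rintro (⟨h, -⟩ | h | h)
    · rw [h, Finsupp.zero_apply] at hi
      omega
    · exact h
    · have := h.1.2.1 i
      rw [Finsupp.neg_apply, hi] at this
      omega
  · exact fun h => Or.inr (Or.inl h)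

theorem pair_notMem_roots {i p : ImIndex} (hip : i ≠ p) (l : ℤ) {a b : ℤ} (ha : 1 ≤ a)
    (hb : 1 ≤ b) : l • αre + a • αim i + -b • αim p ∉ roots := by
  classical
  have hi : (Finsupp.single i a + Finsupp.single p (-b) : ImIndex →₀ ℤ) i = a := by
    simp [hip.symm]
  have hp : (Finsupp.single i a + Finsupp.single p (-b) : ImIndex →₀ ℤ) p = -b := by
    simp [hip]
  rw [← latticeElt_lat_pair, latticeElt_lat_mem_roots_iff]
  rintro (⟨h, -⟩ | h | h)
  · rw [h, Finsupp.zero_apply] at hi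
    omega
  · have := h.1.2.1 p
    rw [hp] at this
    omega
  · have := h.1.2.1 i
    rw [Finsupp.neg_apply, hi] at this
    omega

/-! ### Root spans -/

section RootSpan

variable {V : Type*} [AddCommGroup V] {Δ : Set V} {α β : V}

theorem rootSpan_add_mem (h : α + β ∈ Δ) : α + β ∈ rootSpan Δ α β :=
  Set.mem_iUnion.2 ⟨0, rfl, h⟩

theorem rootSpan_add_left {γ : V} (hγ : γ ∈ rootSpan Δ α β) (h : γ + α ∈ Δ) :
    γ + α ∈ rootSpan Δ α β := by
  obtain ⟨n, hn⟩ := Set.mem_iUnion.1 hγ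
  exact Set.mem_iUnion.2 ⟨n + 1, ⟨γ, hn, Or.inl rfl⟩, h⟩

theorem rootSpan_add_right {γ : V} (hγ : γ ∈ rootSpan Δ α β) (h : γ + β ∈ Δ) :
    γ + β ∈ rootSpan Δ α β := by
  obtain ⟨n, hn⟩ := Set.mem_iUnion.1 hγ
  exact Set.mem_iUnion.2 ⟨n + 1, ⟨γ, hn, Or.inr rfl⟩, h⟩

theorem rootSpanStep_comm (Δ : Set V) (α β : V) (n : ℕ) :
    rootSpanStep Δ α β n = rootSpanStep Δ β α n := by
  induction n with
  | zero => rw [rootSpanStep, rootSpanStep, add_comm]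
  | succ n ih =>
    rw [rootSpanStep, rootSpanStep, ih]
    simp only [or_comm]

theorem rootSpan_comm (Δ : Set V) (α β : V) : rootSpan Δ α β = rootSpan Δ β α :=
  Set.iUnion_congr (rootSpanStep_comm Δ α β)

theorem rootSpanStep_neg (hΔ : ∀ γ ∈ Δ, -γ ∈ Δ) (n : ℕ) {γ : V}
    (hγ : γ ∈ rootSpanStep Δ α β n) : -γ ∈ rootSpanStep Δ (-α) (-β) n := by
  induction n generalizing γ with
  | zero =>
    obtain ⟨h1, h2⟩ := hγ
    rw [Set.mem_singleton_iff] at h1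
    exact ⟨by rw [h1, neg_add]; rfl, hΔ _ h2⟩
  | succ n ih =>
    obtain ⟨⟨δ, hδ, h1⟩, h2⟩ := hγ
    refine ⟨⟨-δ, ih hδ, ?_⟩, hΔ _ h2⟩
    rcases h1 with rfl | rfl
    · exact Or.inl (neg_add _ _)
    · exact Or.inr (neg_add _ _)

theorem neg_mem_rootSpan (hΔ : ∀ γ ∈ Δ, -γ ∈ Δ) {γ : V} (hγ : γ ∈ rootSpan Δ α β) :
    -γ ∈ rootSpan Δ (-α) (-β) := by
  obtain ⟨n, hn⟩ := Set.mem_iUnion.1 hγ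
  exact Set.mem_iUnion.2 ⟨n, rootSpanStep_neg hΔ n hn⟩

theorem exists_of_mem_rootSpan {γ : V} (hγ : γ ∈ rootSpan Δ α β) :
    γ ∈ Δ ∧ α + β ∈ Δ ∧ ∃ a b : ℤ, 1 ≤ a ∧ 1 ≤ b ∧ γ = a • α + b • β := by
  obtain ⟨n, hn⟩ := Set.mem_iUnion.1 hγ
  clear hγ
  induction n generalizing γ with
  | zero =>
    obtain ⟨h1, h2⟩ := hn
    rw [Set.mem_singleton_iff] at h1
    exact ⟨h2, h1 ▸ h2, 1, 1, le_rfl, le_rfl, by rw [one_smul, one_smul, h1]⟩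
  | succ n ih =>
    obtain ⟨⟨δ, hδ, h1⟩, h2⟩ := hn
    obtain ⟨-, h3, a, b, ha, hb, rfl⟩ := ih hδ
    rcases h1 with rfl | rfl
    · exact ⟨h2, h3, a + 1, b, by omega, hb, by rw [add_smul, one_smul]; abel⟩
    · exact ⟨h2, h3, a, b + 1, ha, by omega, by rw [add_smul, one_smul]; abel⟩

theorem rootSpan_eq_empty (h : α + β ∉ Δ) : rootSpan Δ α β = ∅ :=
  Set.eq_empty_of_forall_notMem fun _ hγ => h (exists_of_mem_rootSpan hγ).2.1

/-- Go from `α + β` to `aα + β` by adding `α`, then to `aα + bβ` by adding `β`. The hypotheses say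
that both legs consist of roots. -/
theorem mem_rootSpan_of_path {a b : ℤ} (ha : 1 ≤ a) (hb : 1 ≤ b)
    (h1 : ∀ k : ℤ, 1 ≤ k → k ≤ a → k • α + (1 : ℤ) • β ∈ Δ)
    (h2 : ∀ k : ℤ, 1 ≤ k → k ≤ b → a • α + k • β ∈ Δ) : a • α + b • β ∈ rootSpan Δ α β := by
  have h3 : a • α + (1 : ℤ) • β ∈ rootSpan Δ α β := by
    clear h2
    induction a, ha using Int.leInduction with
    | base =>
      have := h1 1 le_rfl le_rfl
      rw [one_smul, one_smul] at this ⊢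
      exact rootSpan_add_mem this
    | succ a ha ih =>
      have h4 : (a + 1) • α + (1 : ℤ) • β = a • α + (1 : ℤ) • β + α := by
        rw [add_smul, one_smul, one_smul]
        abel
      have h5 := h1 (a + 1) (by omega) le_rfl
      rw [h4] at h5 ⊢
      exact rootSpan_add_left (ih fun k hk hk' => h1 k hk (by omega)) h5
  clear h1
  induction b, hb using Int.leInduction with
  | base => exact h3
  | succ b hb ih =>
    have h4 : a • α + (b + 1) • β = a • α + b • β + β := by
      rw [add_smul, one_smul, add_assoc]
    have h5 := h2 (b + 1) (by omega) le_rfl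
    rw [h4] at h5 ⊢
    exact rootSpan_add_right (ih fun k hk hk' => h2 k hk (by omega)) h5

end RootSpan

/-! ### Root spans in the root system of `𝔤(A)` -/

/-- The region `{(x, y) | y < x d} ∪ {(1, d)}`. -/
def InCone (d x y : ℤ) : Prop := y < x * d ∨ (x = 1 ∧ y = d)

/-- A point with `y ≥ 1` forces `d > 0`, so increasing `x` only relaxes the bound on `y`. Together
with `InCone.one`, this keeps the paths of `mem_rootSpan_of_path` inside the root system. -/
theorem InCone.mono {d x y x' y' : ℤ} (h : InCone d x y) (hx : 1 ≤ x) (hxx : x ≤ x')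
    (hy' : 1 ≤ y') (hyy : y' ≤ y) : InCone d x' y' := by
  rcases h with h | ⟨rfl, rfl⟩
  · have hd : 0 < d := by
      by_contra hd
      have := mul_nonpos_of_nonneg_of_nonpos (show 0 ≤ x by omega) (not_lt.1 hd)
      omega
    exact Or.inl (by have := mul_le_mul_of_nonneg_right hxx hd.le; omega)
  · rcases hxx.eq_or_lt with rfl | hlt
    · rcases hyy.eq_or_lt with rfl | hlt
      · exact Or.inr ⟨rfl, rfl⟩
      · exact Or.inl (by omega)
    · refine Or.inl ?_
      have := mul_le_mul_of_nonneg_right (show (2 : ℤ) ≤ x' by omega) (show 0 ≤ y by omega)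
      omega

theorem InCone.one {d x y : ℤ} (h : InCone d x y) (hx : 1 ≤ x) (hy : 1 ≤ y) {k : ℤ}
    (hk : 1 ≤ k) : InCone d k 1 := by
  have hd : 1 ≤ d := by
    rcases h with h | ⟨-, rfl⟩
    · by_contra hd
      have := mul_nonpos_of_nonneg_of_nonpos (show 0 ≤ x by omega) (show d ≤ 0 by omega)
      omega
    · exact hy
  have h1 : InCone d 1 1 := by
    rcases hd.eq_or_lt with rfl | hd
    · exact Or.inr ⟨rfl, rfl⟩
    · exact Or.inl (by omega)
  exact h1.mono le_rfl hk le_rfl le_rfl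

/-- Positivity of the `α_{-1}` coefficient is automatic, so only the upper bound matters. It is
strict except for `x = 1`, where the endpoint `y = deg i - 1 - l` is a root too. -/
theorem up_mem_roots_iff (i : ImIndex) {l : ℤ} (hl : 0 ≤ l) {x y : ℤ} (hx : 1 ≤ x) (hy : 1 ≤ y) :
    (x * l + y) • αre + x • αim i ∈ roots ↔ InCone (i.deg - 1 - l) x y := by
  have h0 : 0 ≤ x * l := mul_nonneg (by omega) hl
  have h1 : x * (i.deg - 1 - l) = (i.deg - 1) * x - x * l := by ring
  rw [single_mem_roots_iff i _ hx, InCone, h1]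
  constructor
  · rintro (⟨rfl, h2, h3⟩ | ⟨h2, h3⟩)
    · omega
    · omega
  · rintro (h | ⟨rfl, rfl⟩)
    · right
      omega
    · left
      omega

theorem down_mem_roots_iff (i : ImIndex) {l : ℤ} (hl : l < i.deg) {x y : ℤ} (hx : 1 ≤ x)
    (hy : 1 ≤ y) : (x * l - y) • αre + x • αim i ∈ roots ↔ InCone l x y := by
  have h0 : x * l ≤ x * (i.deg - 1) := mul_le_mul_of_nonneg_left (by omega) (by omega)
  have h1 : (i.deg - 1) * x = x * (i.deg - 1) := by ring
  rw [single_mem_roots_iff i _ hx, InCone, h1]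
  constructor
  · rintro (⟨rfl, h2, h3⟩ | ⟨h2, h3⟩)
    · omega
    · omega
  · rintro (h | ⟨rfl, rfl⟩)
    · right
      omega
    · left
      omega

/-! ### The root spans case by case -/

theorem sig_re_re : Sig αre αre = ∅ := by
  refine rootSpan_eq_empty ?_
  rw [show αre + αre = (2 : ℤ) • αre by module, re_mem_roots_iff]
  omega

theorem sig_re_neg_re : Sig αre (-αre) = ∅ := by
  refine rootSpan_eq_empty ?_
  rw [show αre + -αre = (0 : ℤ) • αre by module, re_mem_roots_iff]
  omega

theorem smul_ext_add_smul_re (i : ImIndex) (l a b : ℤ) :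
    a • αext l i + b • αre = (a * l + b) • αre + a • αim i := by
  rw [αext]
  module

theorem smul_ext_add_smul_neg_re (i : ImIndex) (l a b : ℤ) :
    a • αext l i + b • -αre = (a * l - b) • αre + a • αim i := by
  rw [αext]
  module

theorem sig_ext_re (i : ImIndex) {l : ℤ} (hl : 0 ≤ l) : Sig (αext l i) αre =
    {x | ∃ a b : ℤ, 1 ≤ a ∧ 1 ≤ b ∧ InCone (i.deg - 1 - l) a b ∧
      x = (a * l + b) • αre + a • αim i} := by
  ext x
  constructor
  · intro hx
    obtain ⟨h, -, a, b, ha, hb, rfl⟩ := exists_of_mem_rootSpan hx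
    rw [smul_ext_add_smul_re] at h ⊢
    exact ⟨a, b, ha, hb, (up_mem_roots_iff i hl ha hb).1 h, rfl⟩
  · rintro ⟨a, b, ha, hb, h, rfl⟩
    rw [← smul_ext_add_smul_re]
    refine mem_rootSpan_of_path ha hb (fun k hk _ => ?_) (fun k hk hk' => ?_)
    · rw [smul_ext_add_smul_re, up_mem_roots_iff i hl hk le_rfl]
      exact h.one ha hb hk
    · rw [smul_ext_add_smul_re, up_mem_roots_iff i hl ha hk]
      exact h.mono ha le_rfl hk hk'

theorem sig_ext_neg_re (i : ImIndex) {l : ℤ} (hl : l < i.deg) : Sig (αext l i) (-αre) =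
    {x | ∃ a b : ℤ, 1 ≤ a ∧ 1 ≤ b ∧ InCone l a b ∧ x = (a * l - b) • αre + a • αim i} := by
  ext x
  constructor
  · intro hx
    obtain ⟨h, -, a, b, ha, hb, rfl⟩ := exists_of_mem_rootSpan hx
    rw [smul_ext_add_smul_neg_re] at h ⊢
    exact ⟨a, b, ha, hb, (down_mem_roots_iff i hl ha hb).1 h, rfl⟩
  · rintro ⟨a, b, ha, hb, h, rfl⟩
    rw [← smul_ext_add_smul_neg_re]
    refine mem_rootSpan_of_path ha hb (fun k hk _ => ?_) (fun k hk hk' => ?_)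
    · rw [smul_ext_add_smul_neg_re, down_mem_roots_iff i hl hk le_rfl]
      exact h.one ha hb hk
    · rw [smul_ext_add_smul_neg_re, down_mem_roots_iff i hl ha hk]
      exact h.mono ha le_rfl hk hk'

theorem not_inCone_zero {x y : ℤ} (hy : 1 ≤ y) : ¬InCone 0 x y := by
  rintro (h | h) <;> omega

theorem sig_ext_re_eq_empty (i : ImIndex) {l : ℤ} (hl : 0 ≤ l) (h : l = i.deg - 1) :
    Sig (αext l i) αre = ∅ := by
  rw [sig_ext_re i hl, Set.eq_empty_iff_forall_notMem]
  rintro x ⟨a, b, -, hb, hc, -⟩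
  rw [h, sub_self] at hc
  exact not_inCone_zero hb hc

theorem sig_ext_neg_re_eq_empty (i : ImIndex) {l : ℤ} (hl : l < i.deg) (h : l = 0) :
    Sig (αext l i) (-αre) = ∅ := by
  subst h
  rw [sig_ext_neg_re i hl, Set.eq_empty_iff_forall_notMem]
  rintro x ⟨a, b, -, hb, hc, -⟩
  exact not_inCone_zero hb hc

theorem smul_ext_add_smul_ext (i p : ImIndex) (l m a b : ℤ) :
    a • αext l i + b • αext m p = (a * l + b * m) • αre + a • αim i + b • αim p := by
  rw [αext, αext]
  module

theorem smul_ext_add_smul_ext_mem_roots {i p : ImIndex} {l m : ℤ} (hl : 0 ≤ l) (hl' : l < i.deg)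
    (hm : 0 ≤ m) (hm' : m < p.deg) (h : ¬(i = p ∧ l = m ∧ (l = 0 ∨ l = i.deg - 1))) {a b : ℤ}
    (ha : 1 ≤ a) (hb : 1 ≤ b) : a • αext l i + b • αext m p ∈ roots := by
  have h1 : 0 ≤ a * l := mul_nonneg (by omega) hl
  have h2 : 0 ≤ b * m := mul_nonneg (by omega) hm
  have h3 : 0 ≤ a * (i.deg - 1 - l) := mul_nonneg (by omega) (by omega)
  have h4 : 0 ≤ b * (p.deg - 1 - m) := mul_nonneg (by omega) (by omega)
  rw [smul_ext_add_smul_ext]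
  by_cases hip : i = p
  · subst hip
    rw [add_assoc, ← add_smul, single_mem_roots_iff i _ (by omega)]
    right
    -- The excluded cases are exactly those in which both exponents are `0` or both are maximal;
    -- otherwise the two strict bounds follow.
    have h5 : 0 < l ∨ 0 < m := by
      by_contra! hcon
      exact h ⟨rfl, by omega, Or.inl (by omega)⟩
    have h6 : l < i.deg - 1 ∨ m < i.deg - 1 := by
      by_contra! hcon
      exact h ⟨rfl, by omega, Or.inr (by omega)⟩
    constructor
    · rcases h5 with h5 | h5
      · have := mul_pos (show 0 < a by omega) h5
        omega
      · have := mul_pos (show 0 < b by omega) h5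
        omega
    · rcases h6 with h6 | h6
      · have := mul_pos (show 0 < a by omega) (show 0 < i.deg - 1 - l by omega)
        linarith
      · have := mul_pos (show 0 < b by omega) (show 0 < i.deg - 1 - m by omega)
        linarith
  · rw [pair_mem_roots_iff hip _ ha hb]
    constructor <;> linarith

theorem sig_ext_ext {i p : ImIndex} {l m : ℤ} (hl : 0 ≤ l) (hl' : l < i.deg) (hm : 0 ≤ m)
    (hm' : m < p.deg) (h : ¬(i = p ∧ l = m ∧ (l = 0 ∨ l = i.deg - 1))) :
    Sig (αext l i) (αext m p) = {x | ∃ a b : ℤ, 1 ≤ a ∧ 1 ≤ b ∧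
      x = (a * l + b * m) • αre + a • αim i + b • αim p} := by
  ext x
  constructor
  · intro hx
    obtain ⟨-, -, a, b, ha, hb, rfl⟩ := exists_of_mem_rootSpan hx
    exact ⟨a, b, ha, hb, smul_ext_add_smul_ext i p l m a b⟩
  · rintro ⟨a, b, ha, hb, rfl⟩
    rw [← smul_ext_add_smul_ext]
    exact mem_rootSpan_of_path ha hb
      (fun k hk _ => smul_ext_add_smul_ext_mem_roots hl hl' hm hm' h hk le_rfl)
      (fun k hk _ => smul_ext_add_smul_ext_mem_roots hl hl' hm hm' h ha hk)

theorem sig_ext_self_eq_empty (i : ImIndex) {l : ℤ} (h : l = 0 ∨ l = i.deg - 1) :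
    Sig (αext l i) (αext l i) = ∅ := by
  refine rootSpan_eq_empty ?_
  rw [show αext l i + αext l i = (2 * l) • αre + (2 : ℤ) • αim i by rw [αext]; module,
    single_mem_roots_iff i _ (by omega)]
  omega

theorem ext_add_neg_ext (i : ImIndex) (l m : ℤ) : αext l i + -αext m i = (l - m) • αre := by
  rw [αext, αext]
  module

theorem sig_ext_neg_ext_eq_empty (i : ImIndex) {l m : ℤ} (h1 : l - m ≠ 1) (h2 : l - m ≠ -1) :
    Sig (αext l i) (-αext m i) = ∅ := by
  refine rootSpan_eq_empty ?_
  rw [ext_add_neg_ext, re_mem_roots_iff]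
  exact not_or.2 ⟨h1, h2⟩

theorem sig_ext_neg_ext_ne {i p : ImIndex} (hip : i ≠ p) (l m : ℤ) :
    Sig (αext l i) (-αext m p) = ∅ := by
  refine rootSpan_eq_empty ?_
  rw [show αext l i + -αext m p = (l - m) • αre + (1 : ℤ) • αim i + -(1 : ℤ) • αim p by
    rw [αext, αext]; module]
  exact pair_notMem_roots hip _ le_rfl le_rfl

theorem smul_succ_ext_add_smul_neg_ext (i : ImIndex) (m x y : ℤ) :
    (x + y) • αext (m + 1) i + y • -αext m i = (x * (m + 1) + y) • αre + x • αim i := by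
  rw [αext, αext]
  module

theorem smul_neg_ext_add_smul_succ_ext (i : ImIndex) (m x y : ℤ) :
    (x + y) • -αext m i + y • αext (m + 1) i = -((x * m - y) • αre + x • αim i) := by
  rw [αext, αext]
  module

theorem succ_ext_add_neg_ext_mem_roots (i : ImIndex) (m : ℤ) :
    αext (m + 1) i + -αext m i ∈ roots := by
  rw [ext_add_neg_ext, re_mem_roots_iff]
  omega

/-- In `a α_{m+1} - b α_m` the imaginary coefficient is `a - b`. Its sign separates a positive
imaginary root, a multiple of `α_{-1}`, and a negative imaginary root; the cone coordinates are `x =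
|a - b|` and `y = min(a, b)`. -/
theorem sig_succ_ext_neg_ext (i : ImIndex) {m : ℤ} (hm : 0 ≤ m) (hm' : m + 1 < i.deg) :
    Sig (αext (m + 1) i) (-αext m i) = {αre} ∪
      {z | ∃ x y : ℤ, 1 ≤ x ∧ 1 ≤ y ∧ InCone (i.deg - 1 - (m + 1)) x y ∧
        z = (x * (m + 1) + y) • αre + x • αim i} ∪
      {z | ∃ x y : ℤ, 1 ≤ x ∧ 1 ≤ y ∧ InCone m x y ∧
        z = -((x * m - y) • αre + x • αim i)} := by
  ext z
  constructor
  · intro hz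
    obtain ⟨h, -, a, b, ha, hb, rfl⟩ := exists_of_mem_rootSpan hz
    rcases lt_trichotomy a b with hab | rfl | hab
    · right
      have h1 := smul_neg_ext_add_smul_succ_ext i m (b - a) a
      rw [sub_add_cancel, add_comm] at h1
      rw [h1] at h ⊢
      rw [neg_mem_roots_iff, down_mem_roots_iff i (by omega) (by omega) ha] at h
      exact ⟨b - a, a, by omega, ha, h, rfl⟩
    · left
      left
      have h1 : a • αext (m + 1) i + a • -αext m i = a • αre := by
        rw [αext, αext]
        module
      rw [h1] at h ⊢
      rw [re_mem_roots_iff] at h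
      obtain rfl : a = 1 := by omega
      exact one_smul ℤ _
    · left
      right
      have h1 := smul_succ_ext_add_smul_neg_ext i m (a - b) b
      rw [sub_add_cancel] at h1
      rw [h1] at h ⊢
      rw [up_mem_roots_iff i (by omega) (by omega) hb] at h
      exact ⟨a - b, b, by omega, hb, h, rfl⟩
  · rintro ((rfl | ⟨x, y, hx, hy, h, rfl⟩) | ⟨x, y, hx, hy, h, rfl⟩)
    · have h1 := succ_ext_add_neg_ext_mem_roots i m
      have h2 : αext (m + 1) i + -αext m i = αre := by
        rw [αext, αext]
        module
      rw [← h2]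
      exact rootSpan_add_mem h1
    · rw [← smul_succ_ext_add_smul_neg_ext]
      refine mem_rootSpan_of_path (by omega) hy (fun k hk hk' => ?_) (fun k hk hk' => ?_)
      · rcases hk.eq_or_lt with rfl | hk
        · rw [one_smul, one_smul]
          exact succ_ext_add_neg_ext_mem_roots i m
        · have h1 := smul_succ_ext_add_smul_neg_ext i m (k - 1) 1
          rw [sub_add_cancel] at h1
          rw [h1, up_mem_roots_iff i (by omega) (by omega) le_rfl]
          exact h.one hx hy (by omega)
      -- On the second leg `x + y` is fixed while `y` is replaced by `k ≤ y`, so the first cone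
      -- coordinate is at least `x`.
      · have h1 := smul_succ_ext_add_smul_neg_ext i m (x + y - k) k
        rw [sub_add_cancel] at h1
        rw [h1, up_mem_roots_iff i (by omega) (by omega) hk]
        exact h.mono hx (by omega) hk hk'
    -- For the negative part the path must add `-α_m` first, hence the exchange of the two roots.
    · rw [← smul_neg_ext_add_smul_succ_ext, Sig, rootSpan_comm]
      refine mem_rootSpan_of_path (by omega) hy (fun k hk hk' => ?_) (fun k hk hk' => ?_)
      · rcases hk.eq_or_lt with rfl | hk
        · rw [one_smul, one_smul, add_comm]
          exact succ_ext_add_neg_ext_mem_roots i m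
        · have h1 := smul_neg_ext_add_smul_succ_ext i m (k - 1) 1
          rw [sub_add_cancel] at h1
          rw [h1, neg_mem_roots_iff, down_mem_roots_iff i (by omega) (by omega) le_rfl]
          exact h.one hx hy (by omega)
      · have h1 := smul_neg_ext_add_smul_succ_ext i m (x + y - k) k
        rw [sub_add_cancel] at h1
        rw [h1, neg_mem_roots_iff, down_mem_roots_iff i (by omega) (by omega) hk]
        exact h.mono hx (by omega) hk hk'

/-- By `Δ = -Δ` and the symmetry of `Σ`, the case `ℓ - m = -1` is the negative of the case `ℓ - m =
1`. -/
theorem mem_sig_neg_comm {α β γ : Module.Dual ℂ he} : γ ∈ Sig α (-β) ↔ -γ ∈ Sig β (-α) := by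
  have key : ∀ {α β γ : Module.Dual ℂ he}, γ ∈ Sig α (-β) → -γ ∈ Sig β (-α) := by
    intro α β γ h
    have h1 := neg_mem_rootSpan (fun _ => neg_mem_roots) h
    rw [neg_neg, rootSpan_comm] at h1
    exact h1
  exact ⟨key, fun h => neg_neg γ ▸ key h⟩

theorem sig_ext_neg_succ_ext (i : ImIndex) {l : ℤ} (hl : 0 ≤ l) (hl' : l + 1 < i.deg) :
    Sig (αext l i) (-αext (l + 1) i) = {-αre} ∪
      {z | ∃ x y : ℤ, 1 ≤ x ∧ 1 ≤ y ∧ InCone l x y ∧ z = (x * l - y) • αre + x • αim i} ∪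
      {z | ∃ x y : ℤ, 1 ≤ x ∧ 1 ≤ y ∧ InCone (i.deg - 1 - (l + 1)) x y ∧
        z = -((x * (l + 1) + y) • αre + x • αim i)} := by
  ext z
  rw [mem_sig_neg_comm, sig_succ_ext_neg_ext i hl hl', Set.union_right_comm]
  simp only [Set.mem_union, Set.mem_singleton_iff, Set.mem_ofPred_eq, neg_eq_iff_eq_neg, neg_neg]

end MonsterLie

end

theorem mainTheorem11 :
    -- the positive imaginary roots
    (∀ (l : ℤ) (c : MonsterLie.ImIndex →₀ ℤ),
      l • MonsterLie.αre + (c.sum fun i n => n • MonsterLie.αim i) ∈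
          MonsterLie.positiveRoots ∩ MonsterLie.imaginaryRoots ↔
        (0 ≤ l ∧ (∀ i, 0 ≤ c i) ∧ ∃ i, 0 < c i) ∧
        l ≤ (c.sum fun i n => (i.deg - 1) * n) ∧
        ∀ i, (∀ p, c p ≠ 0 ↔ p = i) → c i = 1 ∨ (0 < l ∧ l < (i.deg - 1) * c i)) ∧
    -- `Σ(α_{-1}, ±α_{-1})`
    (MonsterLie.Sig MonsterLie.αre MonsterLie.αre = ∅ ∧
      MonsterLie.Sig MonsterLie.αre (-MonsterLie.αre) = ∅) ∧
    -- `Σ(α_{ℓ,jk}, α_{-1})`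
    (∀ (i : MonsterLie.ImIndex) (l : ℤ), 0 ≤ l →
      (l < i.deg - 1 → MonsterLie.Sig (MonsterLie.αext l i) MonsterLie.αre =
        {x | ∃ a b : ℤ, 1 ≤ a ∧ 1 ≤ b ∧
          (b < a * (i.deg - 1 - l) ∨ (a = 1 ∧ b = i.deg - 1 - l)) ∧
          x = (a * l + b) • MonsterLie.αre + a • MonsterLie.αim i}) ∧
      (l = i.deg - 1 → MonsterLie.Sig (MonsterLie.αext l i) MonsterLie.αre = ∅)) ∧
    -- `Σ(α_{ℓ,jk}, -α_{-1})`
    (∀ (i : MonsterLie.ImIndex) (l : ℤ), l < i.deg →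
      (0 < l → MonsterLie.Sig (MonsterLie.αext l i) (-MonsterLie.αre) =
        {x | ∃ a b : ℤ, 1 ≤ a ∧ 1 ≤ b ∧ (b < a * l ∨ (a = 1 ∧ b = l)) ∧
          x = (a * l - b) • MonsterLie.αre + a • MonsterLie.αim i}) ∧
      (l = 0 → MonsterLie.Sig (MonsterLie.αext l i) (-MonsterLie.αre) = ∅)) ∧
    -- `Σ(α_{ℓ,jk}, α_{m,pq})`
    (∀ (i p : MonsterLie.ImIndex) (l m : ℤ), 0 ≤ l → l < i.deg → 0 ≤ m → m < p.deg →
      (¬(i = p ∧ l = m ∧ (l = 0 ∨ l = i.deg - 1)) →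
        MonsterLie.Sig (MonsterLie.αext l i) (MonsterLie.αext m p) =
          {x | ∃ a b : ℤ, 1 ≤ a ∧ 1 ≤ b ∧
            x = (a * l + b * m) • MonsterLie.αre + a • MonsterLie.αim i + b • MonsterLie.αim p}) ∧
      (i = p ∧ l = m ∧ (l = 0 ∨ l = i.deg - 1) →
        MonsterLie.Sig (MonsterLie.αext l i) (MonsterLie.αext m p) = ∅)) ∧
    -- `Σ(α_{ℓ,jk}, -α_{m,jk})`
    (∀ (i : MonsterLie.ImIndex) (l m : ℤ), 0 ≤ l → l < i.deg → 0 ≤ m → m < i.deg →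
      (l - m = 1 → MonsterLie.Sig (MonsterLie.αext l i) (-MonsterLie.αext m i) =
        {MonsterLie.αre} ∪
        {z | ∃ x y : ℤ, 1 ≤ x ∧ 1 ≤ y ∧
          (y < x * (i.deg - 1 - l) ∨ (x = 1 ∧ y = i.deg - 1 - l)) ∧
          z = (x * l + y) • MonsterLie.αre + x • MonsterLie.αim i} ∪
        {z | ∃ x y : ℤ, 1 ≤ x ∧ 1 ≤ y ∧ (y < x * m ∨ (x = 1 ∧ y = m)) ∧
          z = -((x * m - y) • MonsterLie.αre + x • MonsterLie.αim i)}) ∧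
      (l - m = -1 → MonsterLie.Sig (MonsterLie.αext l i) (-MonsterLie.αext m i) =
        {-MonsterLie.αre} ∪
        {z | ∃ x y : ℤ, 1 ≤ x ∧ 1 ≤ y ∧ (y < x * l ∨ (x = 1 ∧ y = l)) ∧
          z = (x * l - y) • MonsterLie.αre + x • MonsterLie.αim i} ∪
        {z | ∃ x y : ℤ, 1 ≤ x ∧ 1 ≤ y ∧
          (y < x * (i.deg - 1 - m) ∨ (x = 1 ∧ y = i.deg - 1 - m)) ∧
          z = -((x * m + y) • MonsterLie.αre + x • MonsterLie.αim i)}) ∧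
      (l - m ≠ 1 → l - m ≠ -1 →
        MonsterLie.Sig (MonsterLie.αext l i) (-MonsterLie.αext m i) = ∅)) ∧
    -- `Σ(α_{ℓ,jk}, -α_{m,pq})` with `(j, k) ≠ (p, q)`
    (∀ (i p : MonsterLie.ImIndex) (l m : ℤ), 0 ≤ l → l < i.deg → 0 ≤ m → m < p.deg → i ≠ p →
      MonsterLie.Sig (MonsterLie.αext l i) (-MonsterLie.αext m p) = ∅) := by
  refine ⟨fun l c => ?_, ⟨MonsterLie.sig_re_re, MonsterLie.sig_re_neg_re⟩, fun i l hl => ?_,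
    fun i l hl => ?_, fun i p l m hl hl' hm hm' => ?_, fun i l m hl hl' hm hm' => ?_,
    fun i p l m _ _ _ _ hip => MonsterLie.sig_ext_neg_ext_ne hip l m⟩
  · rw [← MonsterLie.latticeElt_lat, MonsterLie.mem_positive_imaginary_iff]
    rfl
  · exact ⟨fun _ => MonsterLie.sig_ext_re i hl, MonsterLie.sig_ext_re_eq_empty i hl⟩
  · exact ⟨fun _ => MonsterLie.sig_ext_neg_re i hl, MonsterLie.sig_ext_neg_re_eq_empty i hl⟩
  · refine ⟨MonsterLie.sig_ext_ext hl hl' hm hm', ?_⟩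
    rintro ⟨rfl, rfl, h⟩
    exact MonsterLie.sig_ext_self_eq_empty i h
  · refine ⟨fun h => ?_, fun h => ?_, MonsterLie.sig_ext_neg_ext_eq_empty i⟩
    · obtain rfl : l = m + 1 := by omega
      exact MonsterLie.sig_succ_ext_neg_ext i hm hl'
    · obtain rfl : m = l + 1 := by omega
      exact MonsterLie.sig_ext_neg_succ_ext i hl hm'
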